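/- Let $f:\mathbb R^n\to\mathbb R$, $G:\mathbb R^n\to\mathbb S^m$, $h:\mathbb R^n\to\mathbb R^s$ be twice continuously differentiable, where $\mathbb S^m$ is the space of real symmetric $m\times m$ matrices, and consider the problem of minimizing $f(x)$ subject to $G(x)\succeq 0$, $h(x)=0$. Notation. $X\bullet Y=\operatorname{tr}(XY)$; $\mathcal L_X:\mathbb S^m\to\mathbb S^m$, $\mathcal L_X(Y)=XY+YX$ for $X\in\mathbb S^m$; $\|A\|_{\rm F}=\sqrt{\operatorname{tr}(A^\top A)}$; $\|\cdot\|$ is the Euclidean norm; $\mathcal G_i(x)=\partial G(x)/\partial x_i$; $\Delta G(x;d)=\sum_i d_i\mathcal G_i(x)$; $\mathcal JG(x)^*Y=(\mathcal G_i(x)\bullet Y)_{i=1}^n$; $\nabla h(x)\in\mathbb R^{n\times s}$ has the gradients of the $h_j$ as columns; $L(x,Y,z)=f(x)-G(x)\bullet Y+h(x)^\top z$. Let $\Lambda(x)$ be the set of all $(Y,z)\in\mathbb S^m\times\mathbb R^s$ with $\nabla_xL(x,Y,z)=0$, $G(x)\bullet Y=0$, $G(x)\succeq0$, $Y\succeq0$,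 $h(x)=0$. For $w=(x,Y,z)$ let $\mathcal A(w)$ be the linear operator on $\mathbb R^n\times\mathbb S^m\times\mathbb R^s$ $$\mathcal A(w)(dx,dY,dz)=\bigl(\nabla^2_{xx}L(w)dx-\mathcal JG(x)^*dY+\nabla h(x)dz,\ \mathcal L_Y\Delta G(x;dx)+\mathcal L_{G(x)}dY,\ \nabla h(x)^\top dx\bigr).$$ Assumptions. Let $x^*$ be a KKT point, i.e. $\Lambda(x^*)\neq\emptyset$. Let $[E,F]$ be an orthogonal matrix with $G(x^*)=[E,F]\begin{bmatrix}O&O\\O&D\end{bmatrix}[E,F]^\top$, $D$ diagonal with positive diagonal entries (so the columns of $E$ span the null space of $G(x^*)$). Assume: (1) strict complementarity: $G(x^*)+Y_*\succ0$ for some $(Y_*,z_*)\in\Lambda(x^*)$; (2) the strong second-order sufficient condition: for all $(Y,z)\in\Lambda(x^*)$ and all $d\ne0$ with $\nabla f(x^*)^\top d=0$, $\nabla h(x^*)^\top d=0$, $E^\top\Delta G(x^*;d)E\succeq0$, one has $d^\top(\nabla^2_{xx}L(x^*,Y,z)+\Omega(x^*,Y))d>0$, where $\Omega(x,Y)_{ij}=2\,Y\bullet\bigl(\mathcal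 G_i(x)G(x)^\dagger\mathcal G_j(x)\bigr)$ and $\dagger$ denotes the Moore–Penrose inverse; (3) the Mangasarian–Fromovitz constraint qualification: $\nabla h(x^*)$ has full column rank, and $G(x^*)+\Delta G(x^*;d)\succ0$, $\nabla h(x^*)^\top d=0$ for some $d\in\mathbb R^n$. Let $(Y_{\rm a},z^{\rm a})$ be the analytic center at $x^*$, i.e. a minimizer of $-\log\det(E^\top YE)$ over $(Y,z)\in\Lambda(x^*)$ (with $\log 0=-\infty$). Let $\xi^*\in\mathbb R^n$ be the $\Delta x$-component of a solution $(\Delta x,\Delta Y)\in\mathbb R^n\times\mathbb S^m$ of $$U^\top\bigl(\nabla^2_{xx}L(x^*,Y_{\rm a},z^{\rm a})\Delta x-\mathcal JG(x^*)^*\Delta Y\bigr)=0,\quad \mathcal L_{G(x^*)}\Delta Y+\mathcal L_{Y_{\rm a}}\Delta G(x^*;\Delta x)=2I,\quad \nabla h(x^*)^\top\Delta x=0,$$ where the columns of $U$ form an orthonormal basis of $\{d: E^\top\Delta G(x^*;d)E=O,\ \nabla h(x^*)^\top d=0\}$. For $\rho,\mu>0$ put $\mathcal P_\rho(\mu)=\{x\in\mathbb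 R^n:\|x^*+\mu\xi^*-x\|<\rho\mu\|\xi^*\|\}$. Claim. Let $\gamma_1,\gamma_2>0$. For all sufficiently small $\bar\mu,\bar\rho>0$ (that is, there are $\mu_0,\rho_0>0$ such that for all $\bar\mu\in(0,\mu_0]$ and $\bar\rho\in(0,\rho_0]$), for every $x\in\bigcup_{\mu'\in(0,\bar\mu]}\mathcal P_{\bar\rho}(\mu')$ the matrix $G(x)$ is positive definite, $\mathcal L_{G(x)}$ is invertible and $\nabla h(x)$ has full column rank, and the following hold. Consider $w=(x,Y,z)\in\mathbb R^n\times\mathbb S^m\times\mathbb R^s$ for which there is $\mu\in(0,\bar\mu]$ with $$x\in\bigcup_{\mu'\in(0,\bar\mu]}\mathcal P_{\bar\rho}(\mu'),\qquad \|Y-\mu G(x)^{-1}\|_{\rm F}\le\gamma_1\mu,\qquad \|\nabla_xL(w)\|\le\gamma_2\mu.$$ 1. For every such $w$ with $Y\succ0$, $$d^\top\nabla^2_{xx}L(w)d+\Delta G(x;d)\bullet\mathcal L_{G(x)}^{-1}\mathcal L_Y\bigl(\Delta G(x;d)\bigr)>0\quad\text{for all } d\in\mathbb R^n\setminus\{0\}\text{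 with }\nabla h(x)^\top d=0.$$ 2. For every such $w$, $\mathcal A(w)$ is nonsingular, i.e. bijective (so every linear system with coefficient operator $\mathcal A(w)$, such as the Newton equations, is uniquely solvable). -/

import Mathlib

open Matrix Set

noncomputable section

/-- The space of real symmetric `m × m` matrices. -/
def SymMat (m : ℕ) : Submodule ℝ (Matrix (Fin m) (Fin m) ℝ) where
  carrier := {A | A.IsSymm}
  add_mem' := fun hA hB => hA.add hB
  zero_mem' := Matrix.isSymm_zero
  smul_mem' := fun c _ hA => hA.smul c

/-- The inner product `X • Y = trace (X Y)` of symmetric matrices. -/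
def symBullet {m : ℕ} (X Y : SymMat m) : ℝ :=
  ((X : Matrix (Fin m) (Fin m) ℝ) * (Y : Matrix (Fin m) (Fin m) ℝ)).trace

/-- The operator `Y ↦ X Y + Y X` on symmetric matrices. -/
def lyapOp {m : ℕ} (X : SymMat m) : Module.End ℝ (SymMat m) where
  toFun Y := ⟨(X : Matrix (Fin m) (Fin m) ℝ) * (Y : Matrix (Fin m) (Fin m) ℝ)
      + (Y : Matrix (Fin m) (Fin m) ℝ) * (X : Matrix (Fin m) (Fin m) ℝ), by
    have hX : (X : Matrix (Fin m) (Fin m) ℝ)ᵀ = X := X.2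
    have hY : (Y : Matrix (Fin m) (Fin m) ℝ)ᵀ = Y := Y.2
    change (_ + _)ᵀ = _
    rw [transpose_add, transpose_mul, transpose_mul, hX, hY, add_comm]⟩
  map_add' Y Z := by
    apply Subtype.ext
    simp only [Submodule.coe_add, mul_add, add_mul]
    abel
  map_smul' c Y := by
    apply Subtype.ext
    simp [smul_add]

/-- The Frobenius norm. -/
def frobNorm {m : ℕ} (A : Matrix (Fin m) (Fin m) ℝ) : ℝ :=
  Real.sqrt (Aᵀ * A).trace

/-- The four Penrose equations: `B` is the Moore-Penrose inverse of `A`. -/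
structure IsMoorePenrose {m : ℕ} (A B : Matrix (Fin m) (Fin m) ℝ) : Prop where
  mul_mul_left : A * B * A = A
  mul_mul_right : B * A * B = B
  symm_left : (A * B)ᵀ = A * B
  symm_right : (B * A)ᵀ = B * A

open Classical in
/-- The Moore-Penrose inverse of a matrix. -/
def moorePenrose {m : ℕ} (A : Matrix (Fin m) (Fin m) ℝ) : Matrix (Fin m) (Fin m) ℝ :=
  if h : ∃ B, IsMoorePenrose A B then h.choose else 0

theorem IsMoorePenrose.unique {m : ℕ} {A B C : Matrix (Fin m) (Fin m) ℝ}
    (hB : IsMoorePenrose A B) (hC : IsMoorePenrose A C) : B = C := by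
  have h1 : A * B = A * C := by
    calc A * B = (A * B)ᵀ := hB.symm_left.symm
      _ = ((A * C) * (A * B))ᵀ := by rw [← mul_assoc (A * C), hC.mul_mul_left]
      _ = (A * B) * (A * C) := by rw [transpose_mul, hB.symm_left, hC.symm_left]
      _ = A * C := by rw [← mul_assoc (A * B), hB.mul_mul_left]
  have h2 : B * A = C * A := by
    calc B * A = (B * A)ᵀ := hB.symm_right.symm
      _ = ((B * A) * (C * A))ᵀ := by rw [mul_assoc B, ← mul_assoc A, hC.mul_mul_left]
      _ = (C * A) * (B * A) := by rw [transpose_mul, hB.symm_right, hC.symm_right]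
      _ = C * A := by rw [mul_assoc C, ← mul_assoc A, hB.mul_mul_left]
  calc B = B * A * B := hB.mul_mul_right.symm
    _ = C * (A * C) := by rw [h2, mul_assoc, h1]
    _ = C := by rw [← mul_assoc, hC.mul_mul_right]

theorem isMoorePenrose_conj_diagonal {m : ℕ} {U : Matrix (Fin m) (Fin m) ℝ} (hUU : Uᵀ * U = 1)
    (e : Fin m → ℝ) :
    IsMoorePenrose (U * diagonal e * Uᵀ) (U * diagonal (fun i => (e i)⁻¹) * Uᵀ) := by
  have key : ∀ a b : Fin m → ℝ, (U * diagonal a * Uᵀ) * (U * diagonal b * Uᵀ)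
      = U * diagonal (fun i => a i * b i) * Uᵀ := by
    intro a b
    calc (U * diagonal a * Uᵀ) * (U * diagonal b * Uᵀ)
        = U * diagonal a * (Uᵀ * U) * diagonal b * Uᵀ := by simp only [mul_assoc]
      _ = U * (diagonal a * diagonal b) * Uᵀ := by rw [hUU]; simp only [mul_assoc, one_mul]
      _ = _ := by rw [diagonal_mul_diagonal]
  have tr : ∀ a : Fin m → ℝ, (U * diagonal a * Uᵀ)ᵀ = U * diagonal a * Uᵀ := by
    intro a
    simp [transpose_mul, mul_assoc]
  refine ⟨?_, ?_, ?_, ?_⟩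
  · rw [key, key]; congr 3; funext i; exact mul_inv_mul_cancel (e i)
  · rw [key, key]; congr 3; funext i
    by_cases h : e i = 0 <;> simp [h]
  · rw [key, tr]
  · rw [key, tr]

theorem exists_isMoorePenrose {m : ℕ} {A : Matrix (Fin m) (Fin m) ℝ} (hA : A.IsSymm) :
    ∃ B, IsMoorePenrose A B := by
  have hH : A.IsHermitian := by
    change Aᴴ = A
    rw [conjTranspose_eq_transpose_of_trivial]; exact hA
  have hUU : (hH.eigenvectorUnitary : Matrix (Fin m) (Fin m) ℝ)ᵀ *
      (hH.eigenvectorUnitary : Matrix (Fin m) (Fin m) ℝ) = 1 := by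
    have := (Matrix.mem_unitaryGroup_iff'.mp hH.eigenvectorUnitary.2)
    rwa [star_eq_conjTranspose, conjTranspose_eq_transpose_of_trivial] at this
  have hspec : A = (hH.eigenvectorUnitary : Matrix (Fin m) (Fin m) ℝ) *
      diagonal hH.eigenvalues * (hH.eigenvectorUnitary : Matrix (Fin m) (Fin m) ℝ)ᵀ := by
    have h := hH.spectral_theorem
    rw [Unitary.conjStarAlgAut_apply, star_eq_conjTranspose,
      conjTranspose_eq_transpose_of_trivial] at h
    exact h
  have h := isMoorePenrose_conj_diagonal hUU hH.eigenvalues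
  rw [← hspec] at h
  exact ⟨_, h⟩

theorem isMoorePenrose_moorePenrose {m : ℕ} {A : Matrix (Fin m) (Fin m) ℝ} (hA : A.IsSymm) :
    IsMoorePenrose A (moorePenrose A) := by
  have h := exists_isMoorePenrose hA
  rw [moorePenrose, dif_pos h]
  exact h.choose_spec

/-- The Hessian matrix `(∂²g(x)/∂xᵢ∂xⱼ)` of a function on `ℝⁿ`. -/
def hessMat {n : ℕ} (g : EuclideanSpace ℝ (Fin n) → ℝ) (x : EuclideanSpace ℝ (Fin n)) :
    Matrix (Fin n) (Fin n) ℝ :=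
  Matrix.of fun i j =>
    fderiv ℝ (fun y => fderiv ℝ g y (EuclideanSpace.single j 1)) x (EuclideanSpace.single i 1)

/-- `P = [E, F]` is an orthogonal matrix with `A = P diag(0, D) Pᵀ`, where `D` is a diagonal
matrix with positive diagonal entries. So the columns of `E` span the null space of `A`, those of
`F` are eigenvectors for positive eigenvalues, and the number of columns of `F` is the rank
of `A`. -/
structure IsEigenFrame {m p r : ℕ} (A : Matrix (Fin m) (Fin m) ℝ)
    (E : Matrix (Fin m) (Fin p) ℝ) (F : Matrix (Fin m) (Fin r) ℝ) : Prop where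
  orth_left : (fromCols E F)ᵀ * fromCols E F = 1
  orth_right : fromCols E F * (fromCols E F)ᵀ = 1
  diag : ∃ D : Fin r → ℝ, (∀ i, 0 < D i) ∧
    A = fromCols E F *
      (fromBlocks 0 0 0 (diagonal D) : Matrix (Fin p ⊕ Fin r) (Fin p ⊕ Fin r) ℝ) *
      (fromCols E F)ᵀ

/-- The data of the nonlinear semidefinite program
`minimize f(x) subject to G(x) ⪰ 0, h(x) = 0`, with twice continuously differentiable `f`, `G`,
`h` on `ℝⁿ` and values in `ℝ`, the symmetric `m × m` matrices, and `ℝˢ`. -/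
structure NSDP (n m s : ℕ) where
  f : EuclideanSpace ℝ (Fin n) → ℝ
  G : EuclideanSpace ℝ (Fin n) → SymMat m
  h : EuclideanSpace ℝ (Fin n) → EuclideanSpace ℝ (Fin s)
  contDiff_f : ContDiff ℝ 2 f
  contDiff_G : ∀ a b, ContDiff ℝ 2 fun x => (G x : Matrix (Fin m) (Fin m) ℝ) a b
  contDiff_h : ContDiff ℝ 2 h

namespace NSDP

/-- The partial derivative `∂G(x)/∂xᵢ`, taken entrywise. -/
def partialG {n m s : ℕ} (P : NSDP n m s) (i : Fin n) (x : EuclideanSpace ℝ (Fin n)) : SymMat m :=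
  ⟨Matrix.of fun a b =>
      fderiv ℝ (fun y => (P.G y : Matrix (Fin m) (Fin m) ℝ) a b) x (EuclideanSpace.single i 1), by
    apply Matrix.IsSymm.ext
    intro a b
    have hs : (fun y => (P.G y : Matrix (Fin m) (Fin m) ℝ) b a)
        = fun y => (P.G y : Matrix (Fin m) (Fin m) ℝ) a b :=
      funext fun y => Matrix.IsSymm.apply (P.G y).2 a b
    simp only [Matrix.of_apply, hs]⟩

/-- `ΔG(x; d) = ∑ᵢ dᵢ ∂G(x)/∂xᵢ`, as a linear map in `d`. -/
def deltaG {n m s : ℕ} (P : NSDP n m s) (x : EuclideanSpace ℝ (Fin n)) :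
    EuclideanSpace ℝ (Fin n) →ₗ[ℝ] SymMat m where
  toFun d := ∑ i, d i • P.partialG i x
  map_add' d e := by simp [add_smul, Finset.sum_add_distrib]
  map_smul' c d := by simp [mul_smul, Finset.smul_sum]

/-- `Y ↦ (∂G(x)/∂xᵢ • Y)ᵢ`, the adjoint of `ΔG(x; ·)`. -/
def adjG {n m s : ℕ} (P : NSDP n m s) (x : EuclideanSpace ℝ (Fin n)) :
    SymMat m →ₗ[ℝ] EuclideanSpace ℝ (Fin n) where
  toFun Y := WithLp.toLp 2 fun i => symBullet (P.partialG i x) Y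
  map_add' Y Z := by
    ext i; simp [symBullet, mul_add]
  map_smul' c Y := by
    ext i; simp [symBullet]

/-- The `n × s` matrix `∇h(x)`, whose `j`-th column is the gradient of `hⱼ`. -/
def gradH {n m s : ℕ} (P : NSDP n m s) (x : EuclideanSpace ℝ (Fin n)) :
    Matrix (Fin n) (Fin s) ℝ :=
  Matrix.of fun i j => gradient (fun y => P.h y j) x i

/-- The Lagrange function `L(x, Y, z) = f(x) - G(x) • Y + h(x)ᵀ z`. -/
def lagrangian {n m s : ℕ} (P : NSDP n m s) (x : EuclideanSpace ℝ (Fin n)) (Y : SymMat m)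
    (z : EuclideanSpace ℝ (Fin s)) : ℝ :=
  P.f x - symBullet (P.G x) Y + ∑ j, P.h x j * z j

/-- `∇ₓL(x, Y, z)`. -/
def gradL {n m s : ℕ} (P : NSDP n m s) (x : EuclideanSpace ℝ (Fin n)) (Y : SymMat m)
    (z : EuclideanSpace ℝ (Fin s)) : EuclideanSpace ℝ (Fin n) :=
  gradient (fun y => P.lagrangian y Y z) x

/-- `∇²ₓₓL(x, Y, z)`. -/
def hessL {n m s : ℕ} (P : NSDP n m s) (x : EuclideanSpace ℝ (Fin n)) (Y : SymMat m)
    (z : EuclideanSpace ℝ (Fin s)) : Matrix (Fin n) (Fin n) ℝ :=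
  hessMat (fun y => P.lagrangian y Y z) x

/-- The set `Λ(x)` of pairs `(Y, z)` for which the KKT conditions hold at `x`. -/
def multipliers {n m s : ℕ} (P : NSDP n m s) (x : EuclideanSpace ℝ (Fin n)) :
    Set (SymMat m × EuclideanSpace ℝ (Fin s)) :=
  {q | P.gradL x q.1 q.2 = 0 ∧ symBullet (P.G x) q.1 = 0 ∧
    (P.G x : Matrix (Fin m) (Fin m) ℝ).PosSemidef ∧
    (q.1 : Matrix (Fin m) (Fin m) ℝ).PosSemidef ∧ P.h x = 0}

/-- `x` is a KKT point. -/
def IsKKTPoint {n m s : ℕ} (P : NSDP n m s) (x : EuclideanSpace ℝ (Fin n)) : Prop :=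
  (P.multipliers x).Nonempty

/-- Some Lagrange multiplier matrix at `x` satisfies the strict complementarity condition. -/
def StrictComplementarity {n m s : ℕ} (P : NSDP n m s) (x : EuclideanSpace ℝ (Fin n)) : Prop :=
  ∃ q ∈ P.multipliers x,
    ((P.G x : Matrix (Fin m) (Fin m) ℝ) + (q.1 : Matrix (Fin m) (Fin m) ℝ)).PosDef

/-- The Mangasarian-Fromovitz constraint qualification at `x`. -/
def MFCQ {n m s : ℕ} (P : NSDP n m s) (x : EuclideanSpace ℝ (Fin n)) : Prop :=
  (P.G x : Matrix (Fin m) (Fin m) ℝ).PosSemidef ∧ P.h x = 0 ∧ (P.gradH x).rank = s ∧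
    ∃ d : EuclideanSpace ℝ (Fin n),
      ((P.G x + P.deltaG x d : SymMat m) : Matrix (Fin m) (Fin m) ℝ).PosDef ∧
      toEuclideanLin (P.gradH x)ᵀ d = 0

/-- The critical cone at `x`; the columns of `E` are an orthonormal basis of the null space of
`G(x)`, so that the tangent cone of the positive semidefinite cone at `G(x)` is
`{X | Eᵀ X E ⪰ 0}`. -/
def criticalCone {n m s p : ℕ} (P : NSDP n m s) (x : EuclideanSpace ℝ (Fin n))
    (E : Matrix (Fin m) (Fin p) ℝ) : Set (EuclideanSpace ℝ (Fin n)) :=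
  {d | inner ℝ (gradient P.f x) d = 0 ∧ toEuclideanLin (P.gradH x)ᵀ d = 0 ∧
    (Eᵀ * (P.deltaG x d : Matrix (Fin m) (Fin m) ℝ) * E).PosSemidef}

/-- The matrix `Ω(x, Y)` of the sigma term, with entries
`2 Y • (∂G(x)/∂xᵢ) G(x)† (∂G(x)/∂xⱼ)`. -/
def sigmaMat {n m s : ℕ} (P : NSDP n m s) (x : EuclideanSpace ℝ (Fin n)) (Y : SymMat m) :
    Matrix (Fin n) (Fin n) ℝ :=
  Matrix.of fun i j => 2 * ((Y : Matrix (Fin m) (Fin m) ℝ) *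
    ((P.partialG i x : Matrix (Fin m) (Fin m) ℝ) *
      moorePenrose (P.G x : Matrix (Fin m) (Fin m) ℝ) *
      (P.partialG j x : Matrix (Fin m) (Fin m) ℝ))).trace

/-- The strong second-order sufficient condition at `x`. -/
def SSOSC {n m s p : ℕ} (P : NSDP n m s) (x : EuclideanSpace ℝ (Fin n))
    (E : Matrix (Fin m) (Fin p) ℝ) : Prop :=
  ∀ q ∈ P.multipliers x, ∀ d ∈ P.criticalCone x E, d ≠ 0 →
    0 < inner ℝ d (toEuclideanLin (P.hessL x q.1 q.2 + P.sigmaMat x q.1) d)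

/-- `(Y, z)` is an analytic center at `x`: it minimizes `-log det (Eᵀ Y E)` over `Λ(x)`, with
the convention `log 0 = -∞`. The determinant is nonnegative on `Λ(x)`. -/
def IsAnalyticCenter {n m s p : ℕ} (P : NSDP n m s) (x : EuclideanSpace ℝ (Fin n))
    (E : Matrix (Fin m) (Fin p) ℝ) (Y : SymMat m) (z : EuclideanSpace ℝ (Fin s)) : Prop :=
  (Y, z) ∈ P.multipliers x ∧
    IsMinOn (fun q : SymMat m × EuclideanSpace ℝ (Fin s) =>
      -ENNReal.log (ENNReal.ofReal (Eᵀ * (q.1 : Matrix (Fin m) (Fin m) ℝ) * E).det))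
      (P.multipliers x) (Y, z)

/-- The subspace `{d | Eᵀ ΔG(x; d) E = 0, ∇h(x)ᵀ d = 0}`. -/
def tangentSpace {n m s p : ℕ} (P : NSDP n m s) (x : EuclideanSpace ℝ (Fin n))
    (E : Matrix (Fin m) (Fin p) ℝ) : Submodule ℝ (EuclideanSpace ℝ (Fin n)) where
  carrier := {d | Eᵀ * (P.deltaG x d : Matrix (Fin m) (Fin m) ℝ) * E = 0 ∧
    toEuclideanLin (P.gradH x)ᵀ d = 0}
  add_mem' := by
    rintro d e ⟨hd, hd'⟩ ⟨he, he'⟩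
    refine ⟨?_, ?_⟩
    · rw [map_add, Submodule.coe_add, Matrix.mul_add, Matrix.add_mul, hd, he, add_zero]
    · rw [map_add, hd', he', add_zero]
  zero_mem' := by simp
  smul_mem' := by
    rintro c d ⟨hd, hd'⟩
    refine ⟨?_, ?_⟩
    · rw [map_smul, Submodule.coe_smul, Matrix.mul_smul, Matrix.smul_mul, hd, smul_zero]
    · rw [map_smul, hd', smul_zero]

/-- `ξ` is the `Δx`-component of a solution `(Δx, ΔY)` of the linear system
`Uᵀ (∇²ₓₓL Δx - 𝒥G* ΔY) = 0`, `L_G ΔY + L_Y ΔG(x; Δx) = 2 I`, `∇h(x)ᵀ Δx = 0`,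
where the columns of `U` are an orthonormal basis of the subspace `tangentSpace`; the first
equation says that the vector in parentheses is orthogonal to that subspace. -/
def IsCentralDirection {n m s p : ℕ} (P : NSDP n m s) (x : EuclideanSpace ℝ (Fin n))
    (E : Matrix (Fin m) (Fin p) ℝ) (Y : SymMat m) (z : EuclideanSpace ℝ (Fin s))
    (ξ : EuclideanSpace ℝ (Fin n)) : Prop :=
  ∃ ΔY : SymMat m,
    toEuclideanLin (P.hessL x Y z) ξ - P.adjG x ΔY ∈ (P.tangentSpace x E)ᗮ ∧
    ((lyapOp (P.G x) ΔY + lyapOp Y (P.deltaG x ξ) : SymMat m) : Matrix (Fin m) (Fin m) ℝ)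
      = (2 : ℝ) • (1 : Matrix (Fin m) (Fin m) ℝ) ∧
    toEuclideanLin (P.gradH x)ᵀ ξ = 0

/-- The operator `𝒜(w)` on `ℝⁿ × 𝕊ᵐ × ℝˢ`, for `w = (x, Y, z)`, with block rows
`[∇²ₓₓL(w), -𝒥G(x)*, ∇h(x)]`, `[L_Y ΔG(x; ·), L_{G(x)}, 0]`, `[∇h(x)ᵀ, 0, 0]`. -/
def jacobianA {n m s : ℕ} (P : NSDP n m s) (x : EuclideanSpace ℝ (Fin n)) (Y : SymMat m)
    (z : EuclideanSpace ℝ (Fin s)) :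
    (EuclideanSpace ℝ (Fin n) × SymMat m × EuclideanSpace ℝ (Fin s)) →ₗ[ℝ]
      (EuclideanSpace ℝ (Fin n) × SymMat m × EuclideanSpace ℝ (Fin s)) where
  toFun w :=
    (toEuclideanLin (P.hessL x Y z) w.1 - P.adjG x w.2.1 + toEuclideanLin (P.gradH x) w.2.2,
      lyapOp Y (P.deltaG x w.1) + lyapOp (P.G x) w.2.1,
      toEuclideanLin (P.gradH x)ᵀ w.1)
  map_add' v w := by
    ext1
    · simp only [Prod.fst_add, Prod.snd_add, map_add]; abel
    · ext1
      · simp only [Prod.fst_add, Prod.snd_add, map_add]; abel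
      · simp only [Prod.fst_add, Prod.snd_add, map_add]
  map_smul' c v := by
    ext1
    · simp only [Prod.smul_fst, Prod.smul_snd, map_smul, smul_sub, smul_add, RingHom.id_apply]
    · ext1
      · simp only [Prod.smul_fst, Prod.smul_snd, map_smul, smul_add, RingHom.id_apply]
      · simp only [Prod.smul_fst, Prod.smul_snd, map_smul, RingHom.id_apply]

/-- The conditions `‖Y - μ G(x)⁻¹‖_F ≤ γ₁ μ` and `‖∇ₓL(x, Y, z)‖ ≤ γ₂ μ`. -/
def NearCentral {n m s : ℕ} (P : NSDP n m s) (γ₁ γ₂ μ : ℝ) (x : EuclideanSpace ℝ (Fin n))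
    (Y : SymMat m) (z : EuclideanSpace ℝ (Fin s)) : Prop :=
  frobNorm ((Y : Matrix (Fin m) (Fin m) ℝ) - μ • (P.G x : Matrix (Fin m) (Fin m) ℝ)⁻¹) ≤ γ₁ * μ ∧
    ‖P.gradL x Y z‖ ≤ γ₂ * μ

end NSDP

/-- The set `𝒫_ρ(μ) = {x | ‖x* + μ ξ* - x‖ < ρ μ ‖ξ*‖}`. -/
def conePiece {n : ℕ} (xs ξ : EuclideanSpace ℝ (Fin n)) (ρ μ : ℝ) :
    Set (EuclideanSpace ℝ (Fin n)) :=
  {x | ‖xs + μ • ξ - x‖ < ρ * μ * ‖ξ‖}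

/-- The union of the sets `𝒫_ρ(μ)` over `μ ∈ (0, μbar]`. -/
def coneRegion {n : ℕ} (xs ξ : EuclideanSpace ℝ (Fin n)) (ρ μbar : ℝ) :
    Set (EuclideanSpace ℝ (Fin n)) :=
  ⋃ μ ∈ Ioc 0 μbar, conePiece xs ξ ρ μ

end

/-! Everything is proved by contradiction and compactness. Write `A = G(x*)`, `N = A†`, `Q = E Eᵀ`,
`R = F Fᵀ`. If no small radius worked, there would be points `x k` with `(x k - x*) / τ k → ξ*` and
`τ k → 0`; limits are taken along the ultrafilter `hyperfilter ℕ`, so bounded quantities converge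
without passing to subsequences.

Near `x*` the matrix `G(x)` has a block of size `τ` on the range of `Q` and a block of order one on
the range of `R`. Conjugation by `T = τ^(-1/2) Q + R` balances them: `T G T → Q ΔG(x*; ξ*) Q + A`.
The equations defining `ξ*` identify this limit as `(Ya + N)⁻¹` (`IsEigenFrame.inv_eq_of_central`).
The limit is positive definite because strict complementarity makes the analytic center positive
definite on the range of `E`. Hence `G(x k)` is eventually positive definite and `τ G⁻¹ → Q (Ya + N)
Q = Ya`.

Approximate stationarity together with MFCQ then forces `μ / τ → 1` if `Ya ≠ 0` (`tendsto_ratio`),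
so that `√μ` may serve as the scale, and `(Y, z) → (Ya, za)` (`tendsto_multiplier`).

Suppose the quadratic form is nonpositive at unit vectors `d k → d₀`, and put `V = ΔG(x; d)`. Up to
a remainder, the barrier term is `tr(W M⁻¹ W M⁻¹)` with `M = T G T` and `W = √μ T V T`. An energy
estimate for `G Z + Z G = V` shows that the remainder cannot compete
(`tendsto_sq_smul_lyapunov_solution`), so `W` stays bounded (`exists_limit_of_barrier_nonpos`).
Consequently `Q V Q → 0`, which places `d₀` in the critical cone, and the limit of the barrier term
is at least the sigma term (`two_mul_trace_le`). This contradicts the second-order condition.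
Nonsingularity of the Newton operator follows by eliminating `dY` (`bijective_jacobianA`). -/

section NearCentralPoints

open Filter Topology

/-! ### Limits along ultrafilters and normalization of unbounded families. -/

section UltrafilterLimits

variable {ι : Type*} {V : Type*} [NormedAddCommGroup V]

theorem Ultrafilter.exists_tendsto_of_norm_le [ProperSpace V] (l : Ultrafilter ι) {u : ι → V}
    {C : ℝ} (hu : ∀ᶠ k in l, ‖u k‖ ≤ C) : ∃ v, Tendsto u l (𝓝 v) := by
  obtain ⟨v, -, hv⟩ := (isCompact_closedBall (0 : V) C).ultrafilter_le_nhds (l.map u) (by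
    refine le_principal_iff.2 ?_
    change u ⁻¹' _ ∈ l
    filter_upwards [hu] with k hk
    simpa using hk)
  exact ⟨v, hv⟩

variable [NormedSpace ℝ V]

/-- Along an ultrafilter, every family becomes convergent after division by `1 + ‖u k‖`. -/
theorem Ultrafilter.exists_tendsto_normalized [ProperSpace V] (l : Ultrafilter ι) (u : ι → V) :
    ∃ (t : ℝ) (v : V), Tendsto (fun k => (1 + ‖u k‖)⁻¹) l (𝓝 t) ∧
      Tendsto (fun k => (1 + ‖u k‖)⁻¹ • u k) l (𝓝 v) ∧ (t = 0 → v ≠ 0) := by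
  have hpos : ∀ k, 0 < 1 + ‖u k‖ := fun k => by positivity
  obtain ⟨t, ht⟩ := l.exists_tendsto_of_norm_le (u := fun k => (1 + ‖u k‖)⁻¹) (C := 1)
    (Eventually.of_forall fun k => by
      rw [Real.norm_of_nonneg (inv_nonneg.2 (hpos k).le)]
      exact inv_le_one_of_one_le₀ (by linarith [norm_nonneg (u k)]))
  obtain ⟨v, hv⟩ := l.exists_tendsto_of_norm_le (u := fun k => (1 + ‖u k‖)⁻¹ • u k) (C := 1)
    (Eventually.of_forall fun k => by
      rw [norm_smul, Real.norm_of_nonneg (inv_nonneg.2 (hpos k).le), inv_mul_le_one₀ (hpos k)]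
      linarith)
  refine ⟨t, v, ht, hv, ?_⟩
  rintro rfl rfl
  have h1 : Tendsto (fun k => (1 + ‖u k‖)⁻¹ + ‖(1 + ‖u k‖)⁻¹ • u k‖) l (𝓝 (0 + ‖(0 : V)‖)) :=
    ht.add hv.norm
  have h2 : (fun k => (1 + ‖u k‖)⁻¹ + ‖(1 + ‖u k‖)⁻¹ • u k‖) = fun _ => (1 : ℝ) := by
    funext k
    have := (hpos k).ne'
    rw [norm_smul, Real.norm_of_nonneg (inv_nonneg.2 (hpos k).le)]
    field_simp
  rw [h2] at h1
  have := tendsto_nhds_unique h1 tendsto_const_nhds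
  simp at this

/-- Companion of the normalization: boundedness and convergence of a family are obtained by
excluding `t = 0`, that is, by showing that a blow-up would have a vanishing normalized limit. -/
theorem tendsto_of_tendsto_normalized {l : Filter ι} {u : ι → V} {t : ℝ} {v : V}
    (ht : Tendsto (fun k => (1 + ‖u k‖)⁻¹) l (𝓝 t))
    (hv : Tendsto (fun k => (1 + ‖u k‖)⁻¹ • u k) l (𝓝 v)) (h0 : t ≠ 0) :
    Tendsto u l (𝓝 (t⁻¹ • v)) := by
  refine ((ht.inv₀ h0).smul hv).congr fun k => ?_
  have : 1 + ‖u k‖ ≠ 0 := by positivity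
  rw [smul_smul, inv_inv, mul_inv_cancel₀ this, one_smul]

/-- If linear maps converge to an injective one, then convergence of the images implies
convergence of the arguments. -/
theorem Ultrafilter.tendsto_of_tendsto_apply [ProperSpace V] {W : Type*} [NormedAddCommGroup W]
    [NormedSpace ℝ W] (l : Ultrafilter ι) {T : ι → V →ₗ[ℝ] W} {T₀ : V →ₗ[ℝ] W}
    (hT : ∀ (u : ι → V) (v : V), Tendsto u l (𝓝 v) → Tendsto (fun k => T k (u k)) l (𝓝 (T₀ v)))
    (hinj : ∀ v, T₀ v = 0 → v = 0) {u : ι → V} {v : V}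
    (hu : Tendsto (fun k => T k (u k)) l (𝓝 (T₀ v))) : Tendsto u l (𝓝 v) := by
  -- The normalized limit `w` of the error lies in the kernel of `T₀`, hence is zero. This excludes
  -- blow-up, and the error then tends to `t⁻¹ • 0`.
  obtain ⟨t, w, ht, hw, htw⟩ := l.exists_tendsto_normalized (fun k => u k - v)
  have h1 : Tendsto (fun k => T k (u k - v)) l (𝓝 0) := by
    have := hu.sub (hT (fun _ => v) v tendsto_const_nhds)
    simpa [map_sub] using this
  have h2 := ht.smul h1
  have h3 := hT _ _ hw
  have h4 : T₀ w = 0 := by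
    have h5 : Tendsto (fun k => (1 + ‖u k - v‖)⁻¹ • T k (u k - v)) l (𝓝 (T₀ w)) := by
      simpa using h3
    simpa using tendsto_nhds_unique h5 h2
  have hw0 : w = 0 := hinj w h4
  subst hw0
  have h6 := tendsto_of_tendsto_normalized ht hw fun h => htw h rfl
  simpa using h6.add_const v

end UltrafilterLimits

/-! ### Trace inequalities for positive matrices. -/

section PositiveMatrices

variable {m : ℕ}

open scoped MatrixOrder in
theorem Matrix.PosSemidef.exists_transpose_mul_self {A : Matrix (Fin m) (Fin m) ℝ}
    (hA : A.PosSemidef) : ∃ B : Matrix (Fin m) (Fin m) ℝ, A = Bᵀ * B :=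
  CStarAlgebra.nonneg_iff_eq_star_mul_self.mp hA.nonneg

theorem Matrix.PosDef.exists_isUnit_transpose_mul_self {A : Matrix (Fin m) (Fin m) ℝ}
    (hA : A.PosDef) : ∃ B : Matrix (Fin m) (Fin m) ℝ, IsUnit B ∧ A = Bᵀ * B := by
  obtain ⟨B, hB⟩ := hA.posSemidef.exists_transpose_mul_self
  refine ⟨B, ?_, hB⟩
  have h := hA.isUnit
  rw [hB, isUnit_iff_isUnit_det, det_mul, IsUnit.mul_iff] at h
  exact (isUnit_iff_isUnit_det B).2 h.2

theorem trace_transpose_mul_self_nonneg (A : Matrix (Fin m) (Fin m) ℝ) : 0 ≤ (Aᵀ * A).trace :=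
  (Matrix.posSemidef_conjTranspose_mul_self A).trace_nonneg

theorem eq_zero_of_trace_transpose_mul_self {A : Matrix (Fin m) (Fin m) ℝ}
    (h : (Aᵀ * A).trace = 0) : A = 0 :=
  Matrix.trace_conjTranspose_mul_self_eq_zero_iff.1 h

/-- With `A = Bᵀ B` and `B` invertible, the trace is the squared Frobenius norm of `B X`. -/
theorem Matrix.PosDef.eq_zero_of_trace_conj {A X : Matrix (Fin m) (Fin m) ℝ} (hA : A.PosDef)
    (h : (Xᵀ * A * X).trace = 0) : X = 0 := by
  obtain ⟨B, hB, rfl⟩ := hA.exists_isUnit_transpose_mul_self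
  have h1 : B * X = 0 := by
    apply eq_zero_of_trace_transpose_mul_self
    rw [← h, transpose_mul]
    simp only [mul_assoc]
  exact hB.mul_right_eq_zero.1 h1

theorem Matrix.PosSemidef.trace_conj_nonneg {A : Matrix (Fin m) (Fin m) ℝ} (hA : A.PosSemidef)
    (X : Matrix (Fin m) (Fin m) ℝ) : 0 ≤ (Xᵀ * A * X).trace :=
  (hA.conjTranspose_mul_mul_same X).trace_nonneg

/-- The Lyapunov operator of a positive definite matrix is injective. -/
theorem Matrix.PosDef.eq_zero_of_lyapunov {A X : Matrix (Fin m) (Fin m) ℝ} (hA : A.PosDef)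
    (h : A * X + X * A = 0) : X = 0 := by
  apply hA.eq_zero_of_trace_conj
  have h1 := hA.posSemidef.trace_conj_nonneg X
  have h2 := hA.posSemidef.trace_conj_nonneg Xᵀ
  have h3 : (Xᵀ * A * X).trace + (Xᵀᵀ * A * Xᵀ).trace = 0 := by
    rw [transpose_transpose, trace_mul_comm (X * A), ← trace_add, mul_assoc, ← mul_add, h,
      mul_zero, trace_zero]
  linarith

theorem Matrix.PosSemidef.trace_mul_nonneg {A C : Matrix (Fin m) (Fin m) ℝ} (hA : A.PosSemidef)
    (hC : C.PosSemidef) : 0 ≤ (A * C).trace := by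
  obtain ⟨B, rfl⟩ := hC.exists_transpose_mul_self
  have := hA.trace_conj_nonneg Bᵀ
  rwa [transpose_transpose, mul_assoc, trace_mul_comm, mul_assoc] at this

theorem Matrix.PosSemidef.mul_eq_zero_of_trace {A C : Matrix (Fin m) (Fin m) ℝ}
    (hA : A.PosSemidef) (hC : C.PosSemidef) (h : (A * C).trace = 0) : A * C = 0 := by
  obtain ⟨B, rfl⟩ := hC.exists_transpose_mul_self
  obtain ⟨D, rfl⟩ := hA.exists_transpose_mul_self
  have h1 : D * Bᵀ = 0 := by
    apply eq_zero_of_trace_transpose_mul_self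
    rw [← h, transpose_mul, transpose_transpose, ← mul_assoc (Dᵀ * D), trace_mul_comm _ B]
    simp only [mul_assoc]
  rw [mul_assoc, ← mul_assoc D, h1, zero_mul, mul_zero]

theorem Matrix.PosDef.eq_zero_of_trace_mul {A C : Matrix (Fin m) (Fin m) ℝ}
    (hA : A.PosDef) (hC : C.PosSemidef) (h : (A * C).trace = 0) : C = 0 :=
  hA.isUnit.mul_right_eq_zero.1 (hA.posSemidef.mul_eq_zero_of_trace hC h)

/-- With `J = Bᵀ B`, the trace is the squared Frobenius norm of `B W Bᵀ`. This definiteness is what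
prevents blow-up of the rescaled directions. -/
theorem Matrix.PosDef.eq_zero_of_trace_mul_mul_mul {J W : Matrix (Fin m) (Fin m) ℝ}
    (hJ : J.PosDef) (hW : Wᵀ = W) (h : (W * J * W * J).trace ≤ 0) : W = 0 := by
  obtain ⟨B, hB, rfl⟩ := hJ.exists_isUnit_transpose_mul_self
  have h0 : ((B * W * Bᵀ)ᵀ * (B * W * Bᵀ)).trace = (W * (Bᵀ * B) * W * (Bᵀ * B)).trace := by
    rw [transpose_mul, transpose_mul, hW, transpose_transpose, trace_mul_comm _ (Bᵀ * B)]
    rw [show B * (W * Bᵀ) * (B * W * Bᵀ) = B * (W * (Bᵀ * B) * W * Bᵀ) by simp only [mul_assoc],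
      trace_mul_comm B, trace_mul_comm (Bᵀ * B)]
    simp only [mul_assoc]
  have h1 : B * W * Bᵀ = 0 := by
    apply eq_zero_of_trace_transpose_mul_self
    exact le_antisymm (h0.trans_le h) (trace_transpose_mul_self_nonneg _)
  have hBt : IsUnit Bᵀ := by rwa [isUnit_transpose]
  exact hB.mul_right_eq_zero.1 (hBt.mul_left_eq_zero.1 h1)

theorem Matrix.PosSemidef.trace_mul_mul_mul_nonneg {J W : Matrix (Fin m) (Fin m) ℝ}
    (hJ : J.PosSemidef) (hW : Wᵀ = W) : 0 ≤ (W * J * W * J).trace := by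
  have h := (hJ.conjTranspose_mul_mul_same W).trace_mul_nonneg hJ
  rwa [conjTranspose_eq_transpose_of_trivial, hW] at h

theorem Ultrafilter.eventually_posDef {ι : Type*} (l : Ultrafilter ι)
    {M : ι → Matrix (Fin m) (Fin m) ℝ}
    {M₀ : Matrix (Fin m) (Fin m) ℝ} (hM : Tendsto M l (𝓝 M₀)) (hs : ∀ k, (M k)ᵀ = M k)
    (hM₀ : M₀.PosDef) : ∀ᶠ k in l, (M k).PosDef := by
  by_contra hcon
  rw [← Ultrafilter.eventually_not] at hcon
  have h1 : ∀ k, ∃ v : Fin m → ℝ, ¬ (M k).PosDef → ‖v‖ = 1 ∧ v ⬝ᵥ (M k *ᵥ v) ≤ 0 := by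
    intro k
    by_cases hk : (M k).PosDef
    · exact ⟨0, fun h => absurd hk h⟩
    · have : ∃ v : Fin m → ℝ, v ≠ 0 ∧ v ⬝ᵥ (M k *ᵥ v) ≤ 0 := by
        by_contra! h
        exact hk (Matrix.PosDef.of_dotProduct_mulVec_pos (hs k) fun v hv => h v hv)
      obtain ⟨v, hv, hle⟩ := this
      have hn : ‖v‖ ≠ 0 := norm_ne_zero_iff.2 hv
      refine ⟨‖v‖⁻¹ • v, fun _ => ⟨by rw [norm_smul, norm_inv, norm_norm, inv_mul_cancel₀ hn], ?_⟩⟩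
      rw [mulVec_smul, dotProduct_smul, smul_dotProduct, smul_eq_mul, smul_eq_mul]
      have : 0 ≤ ‖v‖⁻¹ := by positivity
      exact mul_nonpos_of_nonneg_of_nonpos this (mul_nonpos_of_nonneg_of_nonpos this hle)
  choose v hv using h1
  obtain ⟨w, hw⟩ := l.exists_tendsto_of_norm_le (u := v) (C := 1)
    (hcon.mono fun k hk => (hv k hk).1.le)
  have hw1 : ‖w‖ = 1 :=
    tendsto_nhds_unique hw.norm (tendsto_const_nhds.congr' (hcon.mono fun k hk => (hv k hk).1.symm))
  have hc : Continuous fun q : Matrix (Fin m) (Fin m) ℝ × (Fin m → ℝ) => q.2 ⬝ᵥ (q.1 *ᵥ q.2) := by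
    fun_prop
  have hlim : Tendsto (fun k => v k ⬝ᵥ (M k *ᵥ v k)) l (𝓝 (w ⬝ᵥ (M₀ *ᵥ w))) :=
    (hc.tendsto (M₀, w)).comp (hM.prodMk_nhds hw)
  have hle : w ⬝ᵥ (M₀ *ᵥ w) ≤ 0 := le_of_tendsto hlim (hcon.mono fun k hk => (hv k hk).2)
  have hw0 : w ≠ 0 := by
    rintro rfl
    simp at hw1
  have := hM₀.dotProduct_mulVec_pos hw0
  simp only [star_trivial] at this
  linarith

end PositiveMatrices

/-! ### Block scaling of `G` and the limit of the barrier term. -/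

section ScaledBarrier

open scoped Matrix.Norms.Operator

variable {m : ℕ}

/-- `Q` and `R` are complementary orthogonal projections. -/
structure IsComplProj (Q R : Matrix (Fin m) (Fin m) ℝ) : Prop where
  symm_left : Qᵀ = Q
  symm_right : Rᵀ = R
  mul_self_left : Q * Q = Q
  mul_self_right : R * R = R
  mul_right : Q * R = 0
  mul_left : R * Q = 0
  add_eq : Q + R = 1

/-- The matrix acting as multiplication by `c` on the range of `Q` and as the identity on the
range of `R`. -/
def blockScale (Q R : Matrix (Fin m) (Fin m) ℝ) (c : ℝ) : Matrix (Fin m) (Fin m) ℝ := c • Q + R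

namespace IsComplProj

variable {Q R : Matrix (Fin m) (Fin m) ℝ} (h : IsComplProj Q R)
include h

theorem blockScale_mul (c d : ℝ) :
    blockScale Q R c * blockScale Q R d = blockScale Q R (c * d) := by
  simp [blockScale, add_mul, mul_add, h.mul_self_left, h.mul_self_right, h.mul_right, h.mul_left,
    smul_smul, mul_comm d c]

theorem blockScale_one : blockScale Q R 1 = 1 := by simp [blockScale, h.add_eq]

theorem blockScale_transpose (c : ℝ) : (blockScale Q R c)ᵀ = blockScale Q R c := by
  simp [blockScale, h.symm_left, h.symm_right]

theorem left_mul_blockScale (c : ℝ) : Q * blockScale Q R c = c • Q := by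
  simp [blockScale, mul_add, h.mul_self_left, h.mul_right]

theorem right_mul_blockScale (c : ℝ) : R * blockScale Q R c = R := by
  simp [blockScale, mul_add, h.mul_self_right, h.mul_left]

theorem blockScale_mul_left (c : ℝ) : blockScale Q R c * Q = c • Q := by
  simp [blockScale, add_mul, h.mul_self_left, h.mul_left]

theorem blockScale_mul_right (c : ℝ) : blockScale Q R c * R = R := by
  simp [blockScale, add_mul, h.mul_self_right, h.mul_right]

theorem blockScale_mul_blockScale_inv {c : ℝ} (hc : c ≠ 0) :
    blockScale Q R c * blockScale Q R c⁻¹ = 1 := by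
  rw [h.blockScale_mul, mul_inv_cancel₀ hc, h.blockScale_one]

theorem blockScale_inv_mul_blockScale {c : ℝ} (hc : c ≠ 0) :
    blockScale Q R c⁻¹ * blockScale Q R c = 1 := by
  rw [h.blockScale_mul, inv_mul_cancel₀ hc, h.blockScale_one]

end IsComplProj

theorem tendsto_trace {ι : Type*} {l : Filter ι} {A : ι → Matrix (Fin m) (Fin m) ℝ}
    {A₀ : Matrix (Fin m) (Fin m) ℝ} (hA : Tendsto A l (𝓝 A₀)) :
    Tendsto (fun k => (A k).trace) l (𝓝 A₀.trace) :=
  (Continuous.tendsto (continuous_id.matrix_trace) A₀).comp hA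

theorem tendsto_transpose {ι : Type*} {l : Filter ι} {A : ι → Matrix (Fin m) (Fin m) ℝ}
    {A₀ : Matrix (Fin m) (Fin m) ℝ} (hA : Tendsto A l (𝓝 A₀)) :
    Tendsto (fun k => (A k)ᵀ) l (𝓝 A₀ᵀ) :=
  (Continuous.tendsto (continuous_id.matrix_transpose) A₀).comp hA

theorem tendsto_matrix_inv {ι : Type*} {l : Filter ι} {M : ι → Matrix (Fin m) (Fin m) ℝ}
    {M₀ : Matrix (Fin m) (Fin m) ℝ} (hM : Tendsto M l (𝓝 M₀)) (h₀ : IsUnit M₀) :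
    Tendsto (fun k => (M k)⁻¹) l (𝓝 M₀⁻¹) := by
  have hd : M₀.det ≠ 0 := ((isUnit_iff_isUnit_det M₀).1 h₀).ne_zero
  have hdet : Tendsto (fun k => (M k).det) l (𝓝 M₀.det) :=
    (Continuous.tendsto (continuous_id.matrix_det) M₀).comp hM
  have hadj : Tendsto (fun k => (M k).adjugate) l (𝓝 M₀.adjugate) :=
    (Continuous.tendsto (f := fun A : Matrix (Fin m) (Fin m) ℝ => A.adjugate)
      (by fun_prop) M₀).comp hM
  simpa only [Matrix.inv_def, Ring.inverse_eq_inv'] using (hdet.inv₀ hd).smul hadj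

theorem IsComplProj.inv_eq {Q R : Matrix (Fin m) (Fin m) ℝ} (h : IsComplProj Q R)
    (G : Matrix (Fin m) (Fin m) ℝ) {c : ℝ} (hc : c ≠ 0) :
    G⁻¹ = blockScale Q R c⁻¹ * (blockScale Q R c⁻¹ * G * blockScale Q R c⁻¹)⁻¹ *
      blockScale Q R c⁻¹ := by
  have hi : (blockScale Q R c⁻¹)⁻¹ = blockScale Q R c :=
    Matrix.inv_eq_right_inv (h.blockScale_inv_mul_blockScale hc)
  rw [Matrix.mul_inv_rev, Matrix.mul_inv_rev, hi]
  simp only [mul_assoc]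
  rw [h.blockScale_mul_blockScale_inv hc, mul_one, ← mul_assoc,
    h.blockScale_inv_mul_blockScale hc, one_mul]

/-- If the rescaled matrices converge, then `c² G⁻¹` converges to the `Q`-block of the inverse of
the limit as `c → 0`. -/
theorem IsComplProj.tendsto_sq_smul_inv {Q R : Matrix (Fin m) (Fin m) ℝ} (h : IsComplProj Q R)
    {ι : Type*} {l : Filter ι} {s : ι → ℝ} (hs : ∀ k, 0 < s k) (hs0 : Tendsto s l (𝓝 0))
    {G : ι → Matrix (Fin m) (Fin m) ℝ} {M₀ : Matrix (Fin m) (Fin m) ℝ}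
    (hM : Tendsto (fun k => blockScale Q R (s k)⁻¹ * G k * blockScale Q R (s k)⁻¹) l (𝓝 M₀))
    (h₀ : IsUnit M₀) :
    Tendsto (fun k => (s k) ^ 2 • (G k)⁻¹) l (𝓝 (Q * M₀⁻¹ * Q)) := by
  have h1 : ∀ k, s k • blockScale Q R (s k)⁻¹ = Q + s k • R := fun k => by
    rw [blockScale, smul_add, smul_smul, mul_inv_cancel₀ (hs k).ne', one_smul]
  have h2 : Tendsto (fun k => s k • blockScale Q R (s k)⁻¹) l (𝓝 Q) := by
    simp_rw [h1]
    simpa using (tendsto_const_nhds (x := Q)).add (hs0.smul_const R)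
  refine ((h2.mul (tendsto_matrix_inv hM h₀)).mul h2).congr fun k => ?_
  conv_rhs => rw [h.inv_eq (G k) (hs k).ne']
  simp only [smul_mul_assoc, mul_smul_comm, smul_smul, pow_two]

theorem trace_mul_lyapunov {G X Z : Matrix (Fin m) (Fin m) ℝ} :
    (Z * (G * X + X * G)).trace = ((G * Z + Z * G) * X).trace := by
  rw [mul_add, add_mul, trace_add, trace_add, ← mul_assoc, ← mul_assoc, trace_mul_comm (Z * X),
    ← mul_assoc, add_comm]

/-- The matrix `G⁻¹ V G⁻¹` solves the Lyapunov equation with right-hand side `G⁻¹ V + V G⁻¹`, and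
the Lyapunov operator is self-adjoint for the trace form. So the main part of the barrier term is
explicit although `Z` is not. -/
theorem trace_mul_inv_mul_add_mul_inv {G V Z : Matrix (Fin m) (Fin m) ℝ} (hG : IsUnit G)
    (hZ : G * Z + Z * G = V) :
    (Z * (G⁻¹ * V + V * G⁻¹)).trace = (V * G⁻¹ * V * G⁻¹).trace := by
  have hdet := (isUnit_iff_isUnit_det _).1 hG
  have hX : G * (G⁻¹ * V * G⁻¹) + (G⁻¹ * V * G⁻¹) * G = G⁻¹ * V + V * G⁻¹ := by
    rw [mul_assoc G⁻¹, ← mul_assoc G, mul_nonsing_inv _ hdet, one_mul, mul_assoc _ _ G,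
      mul_assoc V, nonsing_inv_mul _ hdet, mul_one, add_comm]
  rw [← hX, trace_mul_lyapunov, hZ]
  simp only [mul_assoc]

theorem IsComplProj.trace_scaled {Q R : Matrix (Fin m) (Fin m) ℝ} (h : IsComplProj Q R)
    (G V : Matrix (Fin m) (Fin m) ℝ) {c : ℝ} (hc : c ≠ 0) :
    ((c • (blockScale Q R c⁻¹ * V * blockScale Q R c⁻¹)) *
      (blockScale Q R c⁻¹ * G * blockScale Q R c⁻¹)⁻¹ *
      (c • (blockScale Q R c⁻¹ * V * blockScale Q R c⁻¹)) *
      (blockScale Q R c⁻¹ * G * blockScale Q R c⁻¹)⁻¹).trace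
      = c ^ 2 * (V * G⁻¹ * V * G⁻¹).trace := by
  conv_rhs => rw [h.inv_eq G hc]
  generalize (blockScale Q R c⁻¹ * G * blockScale Q R c⁻¹)⁻¹ = N
  generalize blockScale Q R c⁻¹ = T
  have : (V * (T * N * T) * V * (T * N * T)).trace = (T * V * T * N * (T * V * T) * N).trace := by
    rw [show V * (T * N * T) * V * (T * N * T) = (V * (T * N * T) * V * T * N) * T by
      simp only [mul_assoc], trace_mul_comm]
    simp only [mul_assoc]
  rw [this]
  simp only [mul_smul_comm, smul_mul_assoc, trace_smul, smul_eq_mul]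
  ring

section Core

variable {Q R : Matrix (Fin m) (Fin m) ℝ} (h : IsComplProj Q R)
  {ι : Type*} (l : Ultrafilter ι) {s : ι → ℝ} (hs : ∀ k, 0 < s k) (hs0 : Tendsto s l (𝓝 0))
  {G : ι → Matrix (Fin m) (Fin m) ℝ} {M₀ : Matrix (Fin m) (Fin m) ℝ}
  (hM : Tendsto (fun k => blockScale Q R (s k)⁻¹ * G k * blockScale Q R (s k)⁻¹) l (𝓝 M₀))
  (hM₀ : M₀.PosDef)
  {V Z : ι → Matrix (Fin m) (Fin m) ℝ} {V₀ : Matrix (Fin m) (Fin m) ℝ}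
  (hV : Tendsto V l (𝓝 V₀)) (hZs : ∀ k, (Z k)ᵀ = Z k)
  (hZ : ∀ k, G k * Z k + Z k * G k = V k)
include h hs hs0 hM hM₀ hV hZs hZ

/-- The solution `Z` of the Lyapunov equation `G Z + Z G = V` is small compared with `c⁻²` and the
size of the rescaled right-hand side `c • T V T`, where `T` is the block scaling by `c⁻¹`. -/
theorem tendsto_sq_smul_lyapunov_solution {σ : ι → ℝ} {t : ℝ} (hσ : Tendsto σ l (𝓝 t))
    {W₀ : Matrix (Fin m) (Fin m) ℝ}
    (hW : Tendsto (fun k => σ k • s k • (blockScale Q R (s k)⁻¹ * V k * blockScale Q R (s k)⁻¹))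
      l (𝓝 W₀)) :
    Tendsto (fun k => σ k • (s k) ^ 2 • Z k) l (𝓝 0) := by
  set T : ι → Matrix (Fin m) (Fin m) ℝ := fun k => blockScale Q R (s k)⁻¹ with hT
  set S : ι → Matrix (Fin m) (Fin m) ℝ := fun k => blockScale Q R (s k) with hS
  set W : ι → Matrix (Fin m) (Fin m) ℝ := fun k => s k • (T k * V k * T k) with hWdef
  set U : ι → Matrix (Fin m) (Fin m) ℝ := fun k => σ k • (S k * Z k) with hU
  have hST : ∀ k, S k * T k = 1 := fun k => h.blockScale_mul_blockScale_inv (hs k).ne'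
  have hTS : ∀ k, T k * S k = 1 := fun k => h.blockScale_inv_mul_blockScale (hs k).ne'
  have hSt : ∀ k, (S k)ᵀ = S k := fun k => h.blockScale_transpose _
  -- Energy identity: both sides equal `tr(Z V)`. The left side is quadratic and coercive in `S Z`;
  -- the right side is linear in `S Z`. Only the `Q`-`Q` block of `V` has to be expressed through
  -- `W`; the other blocks are controlled by `V` itself.
  have henergy : ∀ k, 2 * ((S k * Z k)ᵀ * (T k * G k * T k) * (S k * Z k)).trace
      = ((S k * Z k) * Q * W k * Q).trace + (R * (S k * Z k) * Q * V k).trace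
        + ((S k * Z k)ᵀ * R * V k).trace := by
    intro k
    have e1 : (S k * Z k)ᵀ * (T k * G k * T k) * (S k * Z k) = Z k * G k * Z k := by
      rw [transpose_mul, hSt, hZs]
      calc Z k * S k * (T k * G k * T k) * (S k * Z k)
          = Z k * (S k * T k) * G k * (T k * S k) * Z k := by simp only [mul_assoc]
        _ = _ := by rw [hST, hTS, mul_one, mul_one]
    have e2 : 2 * (Z k * G k * Z k).trace = (Z k * V k).trace := by
      rw [← hZ k, mul_add, trace_add, ← mul_assoc, trace_mul_comm (Z k) (Z k * G k)]
      ring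
    have hQS : Q * S k = s k • Q := h.left_mul_blockScale _
    have hSQ : S k * Q = s k • Q := h.blockScale_mul_left _
    have hRS : R * S k = R := h.right_mul_blockScale _
    have hSR : S k * R = R := h.blockScale_mul_right _
    have hQT : Q * T k = (s k)⁻¹ • Q := h.left_mul_blockScale _
    have hTQ : T k * Q = (s k)⁻¹ • Q := h.blockScale_mul_left _
    have e3 : ((S k * Z k) * Q * W k * Q).trace = (Z k * Q * V k * Q).trace := by
      have hs' := (hs k).ne'
      calc ((S k * Z k) * Q * W k * Q).trace
          = s k * (S k * Z k * (Q * T k) * V k * (T k * Q)).trace := by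
            simp only [hWdef, mul_smul_comm, smul_mul_assoc, trace_smul, smul_eq_mul, mul_assoc]
        _ = s k * ((s k)⁻¹ * ((s k)⁻¹ * (S k * (Z k * Q * V k * Q)).trace)) := by
            rw [hQT, hTQ]
            simp only [mul_smul_comm, smul_mul_assoc, trace_smul, smul_eq_mul, mul_assoc]
        _ = (s k)⁻¹ * ((Z k * Q * V k) * (Q * S k)).trace := by
            rw [trace_mul_comm (S k)]
            simp only [mul_assoc]
            rw [← mul_assoc, mul_inv_cancel₀ hs', one_mul]
        _ = _ := by
            rw [hQS, mul_smul_comm, trace_smul, smul_eq_mul, ← mul_assoc, inv_mul_cancel₀ hs',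
              one_mul]
    have e4 : (R * (S k * Z k) * Q * V k).trace = (Z k * Q * V k * R).trace := by
      rw [← mul_assoc R, hRS, mul_assoc R, mul_assoc R, trace_mul_comm R]
    have e5 : ((S k * Z k)ᵀ * R * V k).trace = (Z k * R * V k).trace := by
      rw [transpose_mul, hSt, hZs, mul_assoc (Z k), hSR]
    rw [e1, e2, e3, e4, e5, ← trace_add, ← mul_add, h.add_eq, mul_one, ← trace_add, ← add_mul,
      ← mul_add, h.add_eq, mul_one]
  obtain ⟨τ, U₀, hτ, hU₀, hτU⟩ := l.exists_tendsto_normalized U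
  set c : ι → ℝ := fun k => (1 + ‖U k‖)⁻¹ with hc
  -- Multiplying by `c² σ²` leaves a spare factor `c` on the linear side, so a blow-up of `U` (`c →
  -- 0`) would make the quadratic side vanish in the limit.
  have hscaled : ∀ k, 2 * ((c k • U k)ᵀ * (T k * G k * T k) * (c k • U k)).trace
      = c k * (((c k • U k) * Q * (σ k • W k) * Q).trace
        + σ k * ((R * (c k • U k) * Q * V k).trace + ((c k • U k)ᵀ * R * V k).trace)) := by
    intro k
    have := henergy k
    simp only [hU, transpose_smul, mul_smul_comm, smul_mul_assoc, trace_smul, smul_eq_mul]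
    linear_combination (c k) ^ 2 * (σ k) ^ 2 * this
  have hQc : Tendsto (fun _ : ι => Q) l (𝓝 Q) := tendsto_const_nhds
  have hRc : Tendsto (fun _ : ι => R) l (𝓝 R) := tendsto_const_nhds
  have hlhs := (tendsto_trace (((tendsto_transpose hU₀).mul hM).mul hU₀)).const_mul 2
  have hrhs := hτ.mul ((tendsto_trace (((hU₀.mul hQc).mul hW).mul hQc)).add
    (hσ.mul ((tendsto_trace (((hRc.mul hU₀).mul hQc).mul hV)).add (tendsto_trace
    (((tendsto_transpose hU₀).mul hRc).mul hV)))))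
  have hlim := tendsto_nhds_unique (hlhs.congr hscaled) hrhs
  have hτ0 : τ ≠ 0 := by
    intro h0
    rw [h0, zero_mul] at hlim
    exact hτU h0 (hM₀.eq_zero_of_trace_conj (by linarith))
  have hUlim := tendsto_of_tendsto_normalized hτ hU₀ hτ0
  have h1 : ∀ k, s k • T k = Q + s k • R := fun k => by
    simp only [hT, blockScale]
    rw [smul_add, smul_smul, mul_inv_cancel₀ (hs k).ne', one_smul]
  have h2 : Tendsto (fun k => s k • T k) l (𝓝 Q) := by
    simp_rw [h1]
    simpa using (tendsto_const_nhds (x := Q)).add (hs0.smul_const R)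
  -- Since `σ s² Z = s (s T) U` with `s T → Q` and `U` convergent, the extra factor `s` gives the
  -- limit zero.
  have h3 := hs0.smul (h2.mul hUlim)
  rw [zero_smul] at h3
  refine h3.congr fun k => ?_
  simp only [hU, smul_mul_assoc, mul_smul_comm, smul_smul]
  rw [show T k * (S k * Z k) = Z k by rw [← mul_assoc, hTS, one_mul]]
  congr 1
  ring

/-- After division by `(1 + ‖W‖)²` the remainder coming from `B` vanishes by the energy estimate. If
`‖W‖` were unbounded, a nonzero limit `W₀` would satisfy `tr(W₀ M₀⁻¹ W₀ M₀⁻¹) ≤ 0`, contrary to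
definiteness. Hence `W = s T V T` converges, and its blocks are read off from the scaling: `Q V Q =
s Q W Q`, the off-diagonal blocks agree with those of `V`, and `R W R = s R V R`. -/
theorem exists_limit_of_barrier_nonpos (hVs : ∀ k, (V k)ᵀ = V k)
    (hG : ∀ᶠ k in l, IsUnit (G k))
    {B : ι → Matrix (Fin m) (Fin m) ℝ} {B₀ : Matrix (Fin m) (Fin m) ℝ} (hB : Tendsto B l (𝓝 B₀))
    {a : ι → ℝ} {a₀ : ℝ} (ha : Tendsto a l (𝓝 a₀)) {Y : ι → Matrix (Fin m) (Fin m) ℝ}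
    (hY : ∀ k, Y k = (s k) ^ 2 • (G k)⁻¹ + (s k) ^ 2 • B k)
    (hle : ∀ᶠ k in l, a k + (Z k * (Y k * V k + V k * Y k)).trace ≤ 0) :
    Q * V₀ * Q = 0 ∧ ∃ W : Matrix (Fin m) (Fin m) ℝ, Wᵀ = W ∧ Q * W * R = Q * V₀ * R ∧
      R * W * Q = R * V₀ * Q ∧ R * W * R = 0 ∧ a₀ + (W * M₀⁻¹ * W * M₀⁻¹).trace ≤ 0 := by
  set T : ι → Matrix (Fin m) (Fin m) ℝ := fun k => blockScale Q R (s k)⁻¹ with hT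
  set W : ι → Matrix (Fin m) (Fin m) ℝ := fun k => s k • (T k * V k * T k) with hWdef
  have hWs : ∀ k, (W k)ᵀ = W k := fun k => by
    simp only [hWdef, transpose_smul, transpose_mul, hVs, hT, h.blockScale_transpose, mul_assoc]
  have hsplit : ∀ᶠ k in l, (Z k * (Y k * V k + V k * Y k)).trace
      = (W k * (T k * G k * T k)⁻¹ * W k * (T k * G k * T k)⁻¹).trace
        + ((s k) ^ 2 • Z k * (B k * V k + V k * B k)).trace := by
    filter_upwards [hG] with k hGk
    have e1 := trace_mul_inv_mul_add_mul_inv hGk (hZ k)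
    have e2 : (W k * (T k * G k * T k)⁻¹ * W k * (T k * G k * T k)⁻¹).trace
        = (s k) ^ 2 * (V k * (G k)⁻¹ * V k * (G k)⁻¹).trace :=
      h.trace_scaled (G k) (V k) (hs k).ne'
    rw [e2, ← e1, hY]
    simp only [mul_add, add_mul, mul_smul_comm, smul_mul_assoc, trace_add, trace_smul, smul_eq_mul]
    ring
  obtain ⟨t, W₀, ht, hW₀, htW⟩ := l.exists_tendsto_normalized W
  set σ : ι → ℝ := fun k => (1 + ‖W k‖)⁻¹ with hσ
  have hrem := tendsto_sq_smul_lyapunov_solution h l hs hs0 hM hM₀ hV hZs hZ ht hW₀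
  have hMi := tendsto_matrix_inv hM hM₀.isUnit
  have hlim : Tendsto (fun k => σ k * σ k * a k
      + (((σ k • W k) * (T k * G k * T k)⁻¹ * (σ k • W k) * (T k * G k * T k)⁻¹).trace
        + σ k * ((σ k • (s k) ^ 2 • Z k) * (B k * V k + V k * B k)).trace)) l
      (𝓝 (t * t * a₀ + ((W₀ * M₀⁻¹ * W₀ * M₀⁻¹).trace
        + t * (0 * (B₀ * V₀ + V₀ * B₀)).trace))) :=
    ((ht.mul ht).mul ha).add ((tendsto_trace (((hW₀.mul hMi).mul hW₀).mul hMi)).add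
      (ht.mul (tendsto_trace (hrem.mul ((hB.mul hV).add (hV.mul hB))))))
  rw [zero_mul, trace_zero, mul_zero, add_zero] at hlim
  have hfin : t * t * a₀ + (W₀ * M₀⁻¹ * W₀ * M₀⁻¹).trace ≤ 0 := by
    refine le_of_tendsto hlim ?_
    filter_upwards [hsplit, hle] with k hk1 hk2
    have : σ k * σ k * (a k + (Z k * (Y k * V k + V k * Y k)).trace) ≤ 0 :=
      mul_nonpos_of_nonneg_of_nonpos (mul_self_nonneg _) hk2
    rw [hk1] at this
    refine le_of_eq_of_le ?_ this
    simp only [mul_smul_comm, smul_mul_assoc, trace_smul, smul_eq_mul]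
    ring
  have hW₀s : W₀ᵀ = W₀ := by
    refine tendsto_nhds_unique (tendsto_transpose hW₀) (hW₀.congr fun k => ?_)
    rw [transpose_smul, hWs]
  -- Here blow-up of `W` is excluded: for `t = 0` the term with `a₀` drops out of `hfin`.
  have ht0 : t ≠ 0 := by
    intro h0
    rw [h0, zero_mul, zero_mul, zero_add] at hfin
    exact htW h0 (hM₀.inv.eq_zero_of_trace_mul_mul_mul hW₀s hfin)
  have hWlim := tendsto_of_tendsto_normalized ht hW₀ ht0
  have hQT : ∀ k, Q * T k = (s k)⁻¹ • Q := fun k => h.left_mul_blockScale _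
  have hTQ : ∀ k, T k * Q = (s k)⁻¹ • Q := fun k => h.blockScale_mul_left _
  have hRT : ∀ k, R * T k = R := fun k => h.right_mul_blockScale _
  have hTR : ∀ k, T k * R = R := fun k => h.blockScale_mul_right _
  have hblock : ∀ (A C : Matrix (Fin m) (Fin m) ℝ) k,
      A * W k * C = s k • ((A * T k) * V k * (T k * C)) := fun A C k => by
    simp only [hWdef, mul_smul_comm, smul_mul_assoc, mul_assoc]
  have hc : ∀ {f : ι → Matrix (Fin m) (Fin m) ℝ} {f₀} (A C : Matrix (Fin m) (Fin m) ℝ),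
      Tendsto f l (𝓝 f₀) → Tendsto (fun k => A * f k * C) l (𝓝 (A * f₀ * C)) := fun A C hf =>
    (tendsto_const_nhds.mul hf).mul tendsto_const_nhds
  refine ⟨?_, t⁻¹ • W₀, by rw [transpose_smul, hW₀s], ?_, ?_, ?_, ?_⟩
  · have h1 := hs0.smul (hc Q Q hWlim)
    rw [zero_smul] at h1
    refine tendsto_nhds_unique (hc Q Q hV) (h1.congr fun k => ?_)
    have hs' := (hs k).ne'
    rw [hblock, hQT, hTQ]
    simp only [mul_smul_comm, smul_mul_assoc, smul_smul]
    rw [show s k * (s k * ((s k)⁻¹ * (s k)⁻¹)) = 1 by field_simp, one_smul]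
  · refine tendsto_nhds_unique (hc Q R hWlim) ((hc Q R hV).congr fun k => ?_)
    rw [hblock, hQT, hTR]
    simp only [smul_mul_assoc, smul_smul]
    rw [mul_inv_cancel₀ (hs k).ne', one_smul]
  · refine tendsto_nhds_unique (hc R Q hWlim) ((hc R Q hV).congr fun k => ?_)
    rw [hblock, hTQ, hRT]
    simp only [mul_smul_comm, smul_smul]
    rw [mul_inv_cancel₀ (hs k).ne', one_smul]
  · have h1 := hs0.smul (hc R R hV)
    rw [zero_smul] at h1
    refine tendsto_nhds_unique (hc R R hWlim) (h1.congr fun k => ?_)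
    rw [hblock, hRT, hTR]
  · have ht2 : 0 < t⁻¹ * t⁻¹ := mul_self_pos.2 (inv_ne_zero ht0)
    have := mul_nonpos_of_nonneg_of_nonpos ht2.le hfin
    refine le_of_eq_of_le ?_ this
    simp only [mul_smul_comm, smul_mul_assoc, trace_smul, smul_eq_mul]
    field_simp

end Core

end ScaledBarrier

/-! ### Gradients, Hessians and Euclidean linear maps. -/

section Calculus

variable {n : ℕ}

theorem gradient_apply (g : EuclideanSpace ℝ (Fin n) → ℝ) (x : EuclideanSpace ℝ (Fin n))
    (i : Fin n) : gradient g x i = fderiv ℝ g x (EuclideanSpace.single i 1) := by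
  have h : inner ℝ (gradient g x) (EuclideanSpace.single i (1 : ℝ))
      = fderiv ℝ g x (EuclideanSpace.single i 1) := by
    simp [gradient]
  rw [← h, EuclideanSpace.inner_single_right]
  simp

theorem sum_smul_single (d : EuclideanSpace ℝ (Fin n)) :
    ∑ i, d i • EuclideanSpace.single i (1 : ℝ) = d := by
  ext j
  simp [Finset.sum_apply, Pi.single_apply]

theorem continuous_fderiv_apply {g : EuclideanSpace ℝ (Fin n) → ℝ} (hg : ContDiff ℝ 2 g)
    (v : EuclideanSpace ℝ (Fin n)) : Continuous fun x => fderiv ℝ g x v :=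
  (hg.continuous_fderiv (by norm_num)).clm_apply continuous_const

theorem contDiff_one_fderiv_apply {g : EuclideanSpace ℝ (Fin n) → ℝ} (hg : ContDiff ℝ 2 g)
    (v : EuclideanSpace ℝ (Fin n)) : ContDiff ℝ 1 fun x => fderiv ℝ g x v :=
  (hg.fderiv_right (m := 1) (by norm_num)).clm_apply contDiff_const

theorem differentiable_fderiv_apply {g : EuclideanSpace ℝ (Fin n) → ℝ} (hg : ContDiff ℝ 2 g)
    (v : EuclideanSpace ℝ (Fin n)) : Differentiable ℝ fun x => fderiv ℝ g x v :=
  (contDiff_one_fderiv_apply hg v).differentiable (by norm_num)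

theorem continuous_hessMat {g : EuclideanSpace ℝ (Fin n) → ℝ} (hg : ContDiff ℝ 2 g) :
    Continuous (hessMat g) := by
  refine continuous_matrix fun i j => ?_
  exact ((contDiff_one_fderiv_apply hg _).continuous_fderiv (by norm_num)).clm_apply
    continuous_const

theorem inner_toEuclideanLin {a b : ℕ} (H : Matrix (Fin a) (Fin b) ℝ)
    (v : EuclideanSpace ℝ (Fin a)) (z : EuclideanSpace ℝ (Fin b)) :
    inner ℝ v (toEuclideanLin H z) = inner ℝ (toEuclideanLin Hᵀ v) z := by
  simp only [EuclideanSpace.inner_eq_star_dotProduct, star_trivial, ofLp_toLpLin,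
    Matrix.toLin'_apply]
  rw [mulVec_transpose, dotProduct_comm, dotProduct_mulVec, dotProduct_comm]

theorem tendsto_toEuclideanLin {a b : ℕ} {ι : Type*} {l : Filter ι}
    {H : ι → Matrix (Fin a) (Fin b) ℝ} {H₀ : Matrix (Fin a) (Fin b) ℝ} (hH : Tendsto H l (𝓝 H₀))
    {z : ι → EuclideanSpace ℝ (Fin b)} {z₀ : EuclideanSpace ℝ (Fin b)} (hz : Tendsto z l (𝓝 z₀)) :
    Tendsto (fun k => toEuclideanLin (H k) (z k)) l (𝓝 (toEuclideanLin H₀ z₀)) := by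
  have hc : Continuous fun q : Matrix (Fin a) (Fin b) ℝ × EuclideanSpace ℝ (Fin b) =>
      toEuclideanLin q.1 q.2 := by
    simp only [toLpLin_apply]
    fun_prop
  have h := (hc.tendsto (H₀, z₀)).comp (hH.prodMk_nhds hz)
  simpa only [Function.comp_def] using h

theorem injective_toEuclideanLin_iff {a b : ℕ} (H : Matrix (Fin a) (Fin b) ℝ) :
    H.rank = b ↔ ∀ z, toEuclideanLin H z = 0 → z = 0 := by
  have h1 : H.rank = b ↔ Function.Injective H.mulVecLin := by
    rw [← LinearMap.ker_eq_bot, ← Submodule.finrank_eq_zero (R := ℝ)]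
    have := H.mulVecLin.finrank_range_add_finrank_ker
    rw [Module.finrank_fin_fun] at this
    rw [Matrix.rank]
    omega
  rw [h1, injective_iff_map_eq_zero]
  constructor
  · intro h z hz
    have := h (WithLp.ofLp z) (by simpa [toLpLin_apply] using hz)
    simpa using this
  · intro h v hv
    have := h (WithLp.toLp 2 v) (by simpa [toLpLin_apply] using hv)
    simpa using this

end Calculus

/-! ### Derivatives of the Lagrangian and their continuity. -/

namespace NSDP

section Derivatives

variable {n m s : ℕ} (P : NSDP n m s)

theorem contDiff_h_apply (j : Fin s) : ContDiff ℝ 2 fun y => P.h y j := by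
  have := P.contDiff_h
  fun_prop

theorem lagrangian_eq (y : EuclideanSpace ℝ (Fin n)) (Y : SymMat m)
    (z : EuclideanSpace ℝ (Fin s)) :
    P.lagrangian y Y z = P.f y - ∑ a, ∑ b, (P.G y : Matrix (Fin m) (Fin m) ℝ) a b *
      (Y : Matrix (Fin m) (Fin m) ℝ) b a + ∑ j, P.h y j * z j := by
  simp [lagrangian, symBullet, Matrix.trace, Matrix.mul_apply]

theorem fderiv_lagrangian_apply (y : EuclideanSpace ℝ (Fin n)) (Y : SymMat m)
    (z : EuclideanSpace ℝ (Fin s)) (v : EuclideanSpace ℝ (Fin n)) :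
    fderiv ℝ (fun y => P.lagrangian y Y z) y v = fderiv ℝ P.f y v
      - ∑ a, ∑ b, fderiv ℝ (fun y => (P.G y : Matrix (Fin m) (Fin m) ℝ) a b) y v *
        (Y : Matrix (Fin m) (Fin m) ℝ) b a + ∑ j, fderiv ℝ (fun y => P.h y j) y v * z j := by
  have hf : HasFDerivAt P.f (fderiv ℝ P.f y) y :=
    (P.contDiff_f.differentiable (by norm_num) y).hasFDerivAt
  have hG : ∀ a b, HasFDerivAt (fun y => (P.G y : Matrix (Fin m) (Fin m) ℝ) a b)
      (fderiv ℝ (fun y => (P.G y : Matrix (Fin m) (Fin m) ℝ) a b) y) y := fun a b =>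
    ((P.contDiff_G a b).differentiable (by norm_num) y).hasFDerivAt
  have hh : ∀ j, HasFDerivAt (fun y => P.h y j) (fderiv ℝ (fun y => P.h y j) y) y := fun j =>
    ((P.contDiff_h_apply j).differentiable (by norm_num) y).hasFDerivAt
  have key := (hf.sub (HasFDerivAt.fun_sum (u := Finset.univ) fun a _ =>
    HasFDerivAt.fun_sum (u := Finset.univ) fun b _ =>
      (hG a b).mul_const ((Y : Matrix (Fin m) (Fin m) ℝ) b a))).add
    (HasFDerivAt.fun_sum (u := Finset.univ) fun j _ => (hh j).mul_const (z j))
  have heq : (fun y => P.lagrangian y Y z) = fun y => P.f y - ∑ a, ∑ b,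
      (P.G y : Matrix (Fin m) (Fin m) ℝ) a b * (Y : Matrix (Fin m) (Fin m) ℝ) b a
        + ∑ j, P.h y j * z j := funext fun y => P.lagrangian_eq y Y z
  rw [heq]
  have key' := key.fderiv
  refine (DFunLike.congr_fun key' v).trans ?_
  simp [mul_comm]

/-- The Hessian is affine in the multipliers with coefficients continuous in `x`; this gives joint
continuity in `(x, Y, z)`. -/
theorem hessL_eq (x : EuclideanSpace ℝ (Fin n)) (Y : SymMat m) (z : EuclideanSpace ℝ (Fin s)) :
    P.hessL x Y z = hessMat P.f x
      - ∑ a, ∑ b, (Y : Matrix (Fin m) (Fin m) ℝ) b a •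
        hessMat (fun y => (P.G y : Matrix (Fin m) (Fin m) ℝ) a b) x
      + ∑ j, z j • hessMat (fun y => P.h y j) x := by
  ext i j
  have hf := (differentiable_fderiv_apply P.contDiff_f (EuclideanSpace.single j 1) x).hasFDerivAt
  have hG := fun a b =>
    (differentiable_fderiv_apply (P.contDiff_G a b) (EuclideanSpace.single j 1) x).hasFDerivAt
  have hh := fun k =>
    (differentiable_fderiv_apply (P.contDiff_h_apply k) (EuclideanSpace.single j 1) x).hasFDerivAt
  have key := (hf.sub (HasFDerivAt.fun_sum (u := Finset.univ) fun a _ =>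
    HasFDerivAt.fun_sum (u := Finset.univ) fun b _ =>
      (hG a b).mul_const ((Y : Matrix (Fin m) (Fin m) ℝ) b a))).add
    (HasFDerivAt.fun_sum (u := Finset.univ) fun k _ => (hh k).mul_const (z k))
  simp only [hessL, hessMat, Matrix.of_apply, fderiv_lagrangian_apply]
  refine (DFunLike.congr_fun key.fderiv (EuclideanSpace.single i 1)).trans ?_
  simp [Matrix.sum_apply]

/-- Stationarity becomes an affine equation in the multipliers, to be solved for `z` and for the
ratio `μ / τ`. -/
theorem gradL_eq (x : EuclideanSpace ℝ (Fin n)) (Y : SymMat m) (z : EuclideanSpace ℝ (Fin s)) :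
    P.gradL x Y z = gradient P.f x - P.adjG x Y + toEuclideanLin (P.gradH x) z := by
  ext i
  rw [gradL, gradient_apply, fderiv_lagrangian_apply]
  simp [gradient_apply, adjG, symBullet, partialG, gradH, Matrix.trace, Matrix.mul_apply,
    toLpLin_apply, Matrix.mulVec, dotProduct]

theorem deltaG_apply (x d : EuclideanSpace ℝ (Fin n)) (a b : Fin m) :
    (P.deltaG x d : Matrix (Fin m) (Fin m) ℝ) a b
      = fderiv ℝ (fun y => (P.G y : Matrix (Fin m) (Fin m) ℝ) a b) x d := by
  conv_rhs => rw [← sum_smul_single d]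
  simp [deltaG, partialG, Matrix.sum_apply, map_sum]

theorem inner_adjG (x v : EuclideanSpace ℝ (Fin n)) (Y : SymMat m) :
    inner ℝ v (P.adjG x Y) = symBullet (P.deltaG x v) Y := by
  simp [PiLp.inner_apply, adjG, deltaG, symBullet, Finset.sum_mul, Matrix.trace_sum, mul_comm]

theorem continuous_gradient_f : Continuous fun x => gradient P.f x := by
  have h := P.contDiff_f.continuous_fderiv (by norm_num)
  exact (InnerProductSpace.toDual ℝ _).symm.continuous.comp h

theorem continuous_partialG (i : Fin n) :
    Continuous fun x => (P.partialG i x : Matrix (Fin m) (Fin m) ℝ) :=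
  continuous_matrix fun a b => continuous_fderiv_apply (P.contDiff_G a b) _

theorem continuous_gradH : Continuous P.gradH := by
  refine continuous_matrix fun i j => ?_
  simp only [gradH, Matrix.of_apply, gradient_apply]
  exact continuous_fderiv_apply (P.contDiff_h_apply j) _

variable {ι : Type*} {l : Filter ι}

theorem tendsto_deltaG {x d : ι → EuclideanSpace ℝ (Fin n)} {x₀ d₀ : EuclideanSpace ℝ (Fin n)}
    (hx : Tendsto x l (𝓝 x₀)) (hd : Tendsto d l (𝓝 d₀)) :
    Tendsto (fun k => (P.deltaG (x k) (d k) : Matrix (Fin m) (Fin m) ℝ)) l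
      (𝓝 (P.deltaG x₀ d₀ : Matrix (Fin m) (Fin m) ℝ)) := by
  have hc : Continuous fun q : EuclideanSpace ℝ (Fin n) × EuclideanSpace ℝ (Fin n) =>
      ∑ i, q.2 i • (P.partialG i q.1 : Matrix (Fin m) (Fin m) ℝ) := by
    refine continuous_finsetSum _ fun i _ => ?_
    have h1 : Continuous fun q : EuclideanSpace ℝ (Fin n) × EuclideanSpace ℝ (Fin n) => q.2 i := by
      fun_prop
    have h2 : Continuous fun q : EuclideanSpace ℝ (Fin n) × EuclideanSpace ℝ (Fin n) =>
        (P.partialG i q.1 : Matrix (Fin m) (Fin m) ℝ) :=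
      (P.continuous_partialG i).comp continuous_fst
    exact h1.smul h2
  have h := (hc.tendsto (x₀, d₀)).comp (hx.prodMk_nhds hd)
  simpa [deltaG, Function.comp_def] using h

theorem tendsto_hessL {x : ι → EuclideanSpace ℝ (Fin n)} {Y : ι → SymMat m}
    {z : ι → EuclideanSpace ℝ (Fin s)} {x₀ : EuclideanSpace ℝ (Fin n)} {Y₀ : SymMat m}
    {z₀ : EuclideanSpace ℝ (Fin s)} (hx : Tendsto x l (𝓝 x₀))
    (hY : Tendsto (fun k => (Y k : Matrix (Fin m) (Fin m) ℝ)) l (𝓝 Y₀))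
    (hz : Tendsto z l (𝓝 z₀)) :
    Tendsto (fun k => P.hessL (x k) (Y k) (z k)) l (𝓝 (P.hessL x₀ Y₀ z₀)) := by
  simp only [hessL_eq]
  have hc : Continuous fun q : EuclideanSpace ℝ (Fin n) × Matrix (Fin m) (Fin m) ℝ ×
      EuclideanSpace ℝ (Fin s) => hessMat P.f q.1
      - ∑ a, ∑ b, q.2.1 b a • hessMat (fun y => (P.G y : Matrix (Fin m) (Fin m) ℝ) a b) q.1
      + ∑ j, q.2.2 j • hessMat (fun y => P.h y j) q.1 := by
    have h1 := continuous_hessMat P.contDiff_f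
    have h2 := fun a b => continuous_hessMat (P.contDiff_G a b)
    have h3 := fun j => continuous_hessMat (P.contDiff_h_apply j)
    fun_prop
  have h := (hc.tendsto (x₀, (Y₀ : Matrix (Fin m) (Fin m) ℝ), z₀)).comp
    (hx.prodMk_nhds (hY.prodMk_nhds hz))
  simpa only [Function.comp_def] using h

/-- First-order expansion of `G` along a family tangent to `ξ`. -/
theorem tendsto_inv_smul_sub_G {x : ι → EuclideanSpace ℝ (Fin n)} {τ : ι → ℝ}
    {x₀ ξ : EuclideanSpace ℝ (Fin n)} (hx : Tendsto x l (𝓝 x₀))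
    (hξ : Tendsto (fun k => (τ k)⁻¹ • (x k - x₀)) l (𝓝 ξ)) :
    Tendsto (fun k => (τ k)⁻¹ • ((P.G (x k) : Matrix (Fin m) (Fin m) ℝ)
      - (P.G x₀ : Matrix (Fin m) (Fin m) ℝ))) l (𝓝 (P.deltaG x₀ ξ : Matrix (Fin m) (Fin m) ℝ)) := by
  refine tendsto_pi_nhds.2 fun a => tendsto_pi_nhds.2 fun b => ?_
  rw [deltaG_apply]
  have hd : Tendsto (fun k => x k - x₀) l (𝓝 0) := by simpa using hx.sub_const x₀
  have h := ((P.contDiff_G a b).differentiable (by norm_num) x₀).hasFDerivAt.hasFDerivWithinAt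
    (s := Set.univ) |>.lim hd (Eventually.of_forall fun _ => trivial) hξ
  simpa using h

end Derivatives

end NSDP

/-! ### The eigenframe of `G(x*)` and the matrix `Y + A†`. -/

section EigenFrame

variable {m p r : ℕ} {A : Matrix (Fin m) (Fin m) ℝ} {E : Matrix (Fin m) (Fin p) ℝ}
  {F : Matrix (Fin m) (Fin r) ℝ} (h : IsEigenFrame A E F)
include h

namespace IsEigenFrame

theorem blocks : Eᵀ * E = 1 ∧ Eᵀ * F = 0 ∧ Fᵀ * E = 0 ∧ Fᵀ * F = 1 := by
  have h1 := h.orth_left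
  rw [transpose_fromCols, fromRows_mul_fromCols, ← fromBlocks_one, fromBlocks_inj] at h1
  exact h1

theorem isComplProj : IsComplProj (E * Eᵀ) (F * Fᵀ) := by
  obtain ⟨h1, h2, h3, h4⟩ := h.blocks
  have h5 := h.orth_right
  rw [transpose_fromCols, fromCols_mul_fromRows] at h5
  refine ⟨by simp, by simp, ?_, ?_, ?_, ?_, h5⟩
  · rw [Matrix.mul_assoc, ← Matrix.mul_assoc Eᵀ, h1, Matrix.one_mul]
  · rw [Matrix.mul_assoc, ← Matrix.mul_assoc Fᵀ, h4, Matrix.one_mul]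
  · rw [Matrix.mul_assoc, ← Matrix.mul_assoc Eᵀ, h2, Matrix.zero_mul, Matrix.mul_zero]
  · rw [Matrix.mul_assoc, ← Matrix.mul_assoc Fᵀ, h3, Matrix.zero_mul, Matrix.mul_zero]

theorem exists_diagonal : ∃ D : Fin r → ℝ, (∀ i, 0 < D i) ∧ A = F * diagonal D * Fᵀ := by
  obtain ⟨D, hD, hA⟩ := h.diag
  refine ⟨D, hD, hA.trans ?_⟩
  rw [transpose_fromCols, fromCols_mul_fromBlocks, fromCols_mul_fromRows]
  simp

theorem posSemidef : A.PosSemidef := by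
  obtain ⟨D, hD, rfl⟩ := h.exists_diagonal
  have := (PosSemidef.diagonal (d := D) fun i => (hD i).le).mul_mul_conjTranspose_same F
  simpa using this

/-- The explicit candidate `F D⁻¹ Fᵀ` satisfies the Penrose equations, and uniqueness identifies it
with the Moore-Penrose inverse. -/
theorem moorePenrose_data : (moorePenrose A).PosSemidef ∧ A * moorePenrose A = F * Fᵀ ∧
    moorePenrose A * A = F * Fᵀ ∧ E * Eᵀ * moorePenrose A = 0 ∧
    moorePenrose A * (E * Eᵀ) = 0 := by
  obtain ⟨h1, h2, h3, h4⟩ := h.blocks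
  obtain ⟨D, hD, hA⟩ := h.exists_diagonal
  have key : ∀ a b : Fin r → ℝ, (F * diagonal a * Fᵀ) * (F * diagonal b * Fᵀ)
      = F * diagonal (fun i => a i * b i) * Fᵀ := by
    intro a b
    calc (F * diagonal a * Fᵀ) * (F * diagonal b * Fᵀ)
        = F * diagonal a * (Fᵀ * F) * diagonal b * Fᵀ := by simp only [Matrix.mul_assoc]
      _ = F * (Matrix.diagonal a * diagonal b) * Fᵀ := by rw [h4]; simp only [Matrix.mul_assoc,
        Matrix.one_mul]
      _ = _ := by rw [diagonal_mul_diagonal]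
  have e1 : A * (F * diagonal (fun i => (D i)⁻¹) * Fᵀ) = F * Fᵀ := by
    rw [hA, key]
    simp only [fun i => mul_inv_cancel₀ (hD i).ne', diagonal_one, Matrix.mul_one]
  have e2 : (F * diagonal (fun i => (D i)⁻¹) * Fᵀ) * A = F * Fᵀ := by
    rw [hA, key]
    simp only [fun i => inv_mul_cancel₀ (hD i).ne', diagonal_one, Matrix.mul_one]
  have hmp : IsMoorePenrose A (F * diagonal (fun i => (D i)⁻¹) * Fᵀ) := by
    refine ⟨?_, ?_, ?_, ?_⟩
    · rw [e1, hA, Matrix.mul_assoc F (Matrix.diagonal D), ← Matrix.mul_assoc,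
        Matrix.mul_assoc F Fᵀ F, h4, Matrix.mul_one]
    · rw [e2, Matrix.mul_assoc F (Matrix.diagonal _), ← Matrix.mul_assoc, Matrix.mul_assoc F Fᵀ F,
        h4, Matrix.mul_one]
    · rw [e1]; simp
    · rw [e2]; simp
  have hsymm : A.IsSymm := h.posSemidef.isHermitian
  have heq := (isMoorePenrose_moorePenrose hsymm).unique hmp
  rw [heq]
  refine ⟨?_, e1, e2, ?_, ?_⟩
  · have := (PosSemidef.diagonal (d := fun i => (D i)⁻¹) fun i =>
      (inv_pos.2 (hD i)).le).mul_mul_conjTranspose_same F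
    simpa using this
  · rw [Matrix.mul_assoc F, ← Matrix.mul_assoc (E * Eᵀ), Matrix.mul_assoc E, h2, Matrix.mul_zero,
      Matrix.zero_mul]
  · rw [Matrix.mul_assoc (F * _), ← Matrix.mul_assoc Fᵀ, h3, Matrix.zero_mul, Matrix.mul_zero]

theorem mul_left_eq_zero : E * Eᵀ * A = 0 ∧ A * (E * Eᵀ) = 0 := by
  obtain ⟨h1, h2, h3, h4⟩ := h.blocks
  obtain ⟨D, hD, rfl⟩ := h.exists_diagonal
  constructor
  · rw [Matrix.mul_assoc F, ← Matrix.mul_assoc (E * Eᵀ), Matrix.mul_assoc E, h2, Matrix.mul_zero,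
      Matrix.zero_mul]
  · rw [Matrix.mul_assoc (F * _), ← Matrix.mul_assoc Fᵀ, h3, Matrix.zero_mul, Matrix.mul_zero]

/-- A positive semidefinite matrix complementary to `A` lives on the null space of `A`. -/
theorem proj_mul_of_complementary {Y : Matrix (Fin m) (Fin m) ℝ} (hY : Y.PosSemidef)
    (hAY : (A * Y).trace = 0) : E * Eᵀ * Y = Y ∧ Y * (E * Eᵀ) = Y := by
  obtain ⟨-, -, e2, -, -⟩ := h.moorePenrose_data
  have h0 := h.posSemidef.mul_eq_zero_of_trace hY hAY
  have h1 : F * Fᵀ * Y = 0 := by rw [← e2, Matrix.mul_assoc, h0, Matrix.mul_zero]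
  have h2 : E * Eᵀ * Y = Y := by
    have : (E * Eᵀ + F * Fᵀ) * Y = Y := by rw [h.isComplProj.add_eq, Matrix.one_mul]
    rwa [Matrix.add_mul, h1, add_zero] at this
  refine ⟨h2, ?_⟩
  have hYs : Yᵀ = Y := hY.isHermitian
  have h3 := congrArg transpose h2
  rwa [transpose_mul, h.isComplProj.symm_left, hYs] at h3

/-- A vector on which the form is not positive is annihilated by both summands. Being annihilated by
`A†` places it in the range of `E`, where `Y` is definite. -/
theorem posDef_add_moorePenrose {Y : Matrix (Fin m) (Fin m) ℝ} (hY : Y.PosSemidef)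
    (hEY : (Eᵀ * Y * E).PosDef) : (Y + moorePenrose A).PosDef := by
  obtain ⟨e0, e1, -, -, -⟩ := h.moorePenrose_data
  refine PosDef.of_dotProduct_mulVec_pos (hY.add e0).isHermitian fun v hv => ?_
  by_contra hcon
  push Not at hcon
  have p1 := hY.dotProduct_mulVec_nonneg v
  have p2 := e0.dotProduct_mulVec_nonneg v
  rw [add_mulVec, dotProduct_add] at hcon
  have q1 := (hY.dotProduct_mulVec_zero_iff v).1 (by linarith)
  have q2 := (e0.dotProduct_mulVec_zero_iff v).1 (by linarith)
  have q3 : (F * Fᵀ) *ᵥ v = 0 := by rw [← e1, ← mulVec_mulVec, q2, mulVec_zero]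
  have q4 : E *ᵥ (Eᵀ *ᵥ v) = v := by
    have : (E * Eᵀ + F * Fᵀ) *ᵥ v = v := by rw [h.isComplProj.add_eq, one_mulVec]
    rwa [add_mulVec, q3, add_zero, ← mulVec_mulVec] at this
  have q5 : (Eᵀ * Y * E) *ᵥ (Eᵀ *ᵥ v) = 0 := by
    rw [← mulVec_mulVec, q4, ← mulVec_mulVec, q1, mulVec_zero]
  have q6 : Eᵀ *ᵥ v ≠ 0 := by
    intro h0
    rw [h0, mulVec_zero] at q4
    exact hv q4.symm
  have := hEY.dotProduct_mulVec_pos q6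
  rw [q5, dotProduct_zero] at this
  exact lt_irrefl _ this

/-- The solution of the linear system of the central direction determines the inverse of
`Y + A†`. -/
theorem inv_eq_of_central {Y X Δ : Matrix (Fin m) (Fin m) ℝ} (hY : Y.PosSemidef)
    (hAY : (A * Y).trace = 0) (hEY : (Eᵀ * Y * E).PosDef)
    (heq : A * X + X * A + (Y * Δ + Δ * Y) = (2 : ℝ) • 1) :
    E * Eᵀ * Δ * (E * Eᵀ) + A = (Y + moorePenrose A)⁻¹ := by
  obtain ⟨e0, e1, e2, e3, e4⟩ := h.moorePenrose_data
  obtain ⟨y1, y2⟩ := h.proj_mul_of_complementary hY hAY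
  obtain ⟨a1, a2⟩ := h.mul_left_eq_zero
  have hQ := h.isComplProj
  have hJ := h.posDef_add_moorePenrose hY hEY
  generalize E * Eᵀ = Q at *
  generalize F * Fᵀ = R at *
  generalize moorePenrose A = N at *
  have hJdet := (isUnit_iff_isUnit_det _).1 hJ.isUnit
  -- Compression by `Q` on both sides removes the unknown `X`, because `Q A = A Q = 0`.
  have h1 : Y * (Q * Δ * Q) + Q * Δ * Q * Y = (2 : ℝ) • Q := by
    have := congrArg (fun B => Q * B * Q) heq
    simp only [Matrix.mul_add, Matrix.add_mul, mul_smul_comm, smul_mul_assoc, Matrix.mul_one,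
      hQ.mul_self_left] at this
    rw [← Matrix.mul_assoc Q A X, a1, Matrix.zero_mul, Matrix.zero_mul, ← Matrix.mul_assoc Q X A,
      Matrix.mul_assoc (Q * X) A Q, a2,
      Matrix.mul_zero, zero_add, zero_add, ← Matrix.mul_assoc Q Y Δ, y1, ← Matrix.mul_assoc Q Δ Y,
      Matrix.mul_assoc (Q * Δ) Y Q,
      y2] at this
    rw [← this, ← Matrix.mul_assoc, ← Matrix.mul_assoc, y2, Matrix.mul_assoc (Q * Δ) Q Y, y1]
  have h2 : Y * A = 0 := by rw [← y2, Matrix.mul_assoc, a1, Matrix.mul_zero]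
  have h3 : A * Y = 0 := by rw [← y1, ← Matrix.mul_assoc, a2, Matrix.zero_mul]
  have h4 : N * (Q * Δ * Q) = 0 := by rw [← Matrix.mul_assoc, ← Matrix.mul_assoc, e4,
    Matrix.zero_mul, Matrix.zero_mul]
  have h5 : Q * Δ * Q * N = 0 := by rw [Matrix.mul_assoc, e3, Matrix.mul_zero]
  -- The cross products vanish and `A N = N A = R`, so the compressed equation with right side `2 Q`
  -- is completed to one with right side `2 I`. The inverse of `Y + N` satisfies the same Lyapunov
  -- equation, whose solution is unique.
  have hsum : (Y + N) * (Q * Δ * Q + A) + (Q * Δ * Q + A) * (Y + N) = (2 : ℝ) • 1 := by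
    rw [Matrix.add_mul, Matrix.add_mul, Matrix.mul_add, Matrix.mul_add, Matrix.mul_add,
      Matrix.mul_add, h2, h3, h4, h5, e1, e2, ← hQ.add_eq,
      smul_add, ← h1, two_smul]
    abel
  have hzero := hJ.eq_zero_of_lyapunov (X := Q * Δ * Q + A - (Y + N)⁻¹) (by
    rw [mul_sub, sub_mul, mul_nonsing_inv _ hJdet, nonsing_inv_mul _ hJdet]
    have : (Y + N) * (Q * Δ * Q + A) - 1 + ((Q * Δ * Q + A) * (Y + N) - 1)
      = (Y + N) * (Q * Δ * Q + A) + (Q * Δ * Q + A) * (Y + N) - (2 : ℝ) • 1 := by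
        rw [two_smul]; abel
    rw [this, hsum, sub_self])
  exact sub_eq_zero.1 hzero

end IsEigenFrame

end EigenFrame

namespace NSDP

variable {n m s p r : ℕ} {P : NSDP n m s} {xs : EuclideanSpace ℝ (Fin n)}
  {E : Matrix (Fin m) (Fin p) ℝ} {F : Matrix (Fin m) (Fin r) ℝ} {Ya : SymMat m}
  {za : EuclideanSpace ℝ (Fin s)}

/-- Since `G(x*) E = 0`, strict complementarity supplies a multiplier with `Eᵀ Y E` positive
definite. The analytic center has at least as large a determinant, and a positive semidefinite
matrix with nonzero determinant is definite. -/
theorem IsAnalyticCenter.posDef (hYa : P.IsAnalyticCenter xs E Ya za)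
    (hEF : IsEigenFrame (P.G xs : Matrix (Fin m) (Fin m) ℝ) E F)
    (hSC : P.StrictComplementarity xs) :
    (Eᵀ * (Ya : Matrix (Fin m) (Fin m) ℝ) * E).PosDef := by
  obtain ⟨q, hq, hpd⟩ := hSC
  obtain ⟨⟨-, -, -, hY, -⟩, hmin⟩ := hYa
  obtain ⟨h1, -, -, -⟩ := hEF.blocks
  have hE : Function.Injective E.mulVec := by
    intro v w hvw
    have := congrArg (fun u => Eᵀ *ᵥ u) hvw
    simpa [mulVec_mulVec, h1] using this
  have hGE : (P.G xs : Matrix (Fin m) (Fin m) ℝ) * E = 0 := by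
    have h2 := hEF.mul_left_eq_zero.2
    have h3 := congrArg (fun B => B * E) h2
    rwa [Matrix.zero_mul, Matrix.mul_assoc, Matrix.mul_assoc, h1, Matrix.mul_one] at h3
  have hq' : (Eᵀ * (q.1 : Matrix (Fin m) (Fin m) ℝ) * E).PosDef := by
    have := hpd.conjTranspose_mul_mul_same hE
    rwa [conjTranspose_eq_transpose_of_trivial, Matrix.mul_add, Matrix.add_mul,
      Matrix.mul_assoc _ (P.G xs : Matrix (Fin m) (Fin m) ℝ) E, hGE, Matrix.mul_zero,
      zero_add] at this
  have hle := isMinOn_iff.1 hmin q hq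
  rw [EReal.neg_le_neg_iff] at hle
  have hle' := ENNReal.log_le_log_iff.1 hle
  have hdet : 0 < (Eᵀ * (Ya : Matrix (Fin m) (Fin m) ℝ) * E).det :=
    ENNReal.ofReal_pos.1 ((ENNReal.ofReal_pos.2 hq'.det_pos).trans_le hle')
  exact ((hY.conjTranspose_mul_mul_same E).posDef_iff_det_ne_zero).2 hdet.ne'

end NSDP

/-! ### The Lyapunov operator and its inverse. -/

section LyapunovOperator

variable {m : ℕ}

theorem isUnit_lyapOp {G : SymMat m} (hG : (G : Matrix (Fin m) (Fin m) ℝ).PosDef) :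
    IsUnit (lyapOp G) := by
  rw [LinearMap.isUnit_iff_ker_eq_bot, LinearMap.ker_eq_bot']
  intro X hX
  apply Subtype.ext
  exact hG.eq_zero_of_lyapunov (congrArg Subtype.val hX)

theorem Ring.apply_inverse_apply {R M : Type*} [CommRing R] [AddCommGroup M] [Module R M]
    {f : Module.End R M} (hf : IsUnit f) (x : M) : f (Ring.inverse f x) = x := by
  have := LinearMap.congr_fun (Ring.mul_inverse_cancel f hf) x
  simpa using this

/-- Self-adjointness moves the inverse operator onto `V`, so only the equation `G Z + Z G = V`,
which does not involve `Y`, has to be estimated. -/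
theorem exists_trace_lyapOp_inverse {G : SymMat m} (hG : (G : Matrix (Fin m) (Fin m) ℝ).PosDef)
    (V : SymMat m) : ∃ Z : SymMat m,
      (G : Matrix (Fin m) (Fin m) ℝ) * Z + (Z : Matrix (Fin m) (Fin m) ℝ) * G = V ∧
      ∀ U : SymMat m, symBullet V (Ring.inverse (lyapOp G) U)
        = ((Z : Matrix (Fin m) (Fin m) ℝ) * (U : Matrix (Fin m) (Fin m) ℝ)).trace := by
  have hu := isUnit_lyapOp hG
  have hZ : (G : Matrix (Fin m) (Fin m) ℝ) * (Ring.inverse (lyapOp G) V : SymMat m)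
      + ((Ring.inverse (lyapOp G) V : SymMat m) : Matrix (Fin m) (Fin m) ℝ) * G = V :=
    congrArg Subtype.val (Ring.apply_inverse_apply hu V)
  refine ⟨Ring.inverse (lyapOp G) V, hZ, fun U => ?_⟩
  have hX : (G : Matrix (Fin m) (Fin m) ℝ) * (Ring.inverse (lyapOp G) U : SymMat m)
      + ((Ring.inverse (lyapOp G) U : SymMat m) : Matrix (Fin m) (Fin m) ℝ) * G = U :=
    congrArg Subtype.val (Ring.apply_inverse_apply hu U)
  rw [symBullet]
  conv_lhs => rw [← hZ]
  conv_rhs => rw [← hX]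
  rw [trace_mul_lyapunov]

theorem abs_apply_le_frobNorm (A : Matrix (Fin m) (Fin m) ℝ) (a b : Fin m) :
    |A a b| ≤ frobNorm A := by
  rw [frobNorm]
  apply Real.abs_le_sqrt
  simp only [Matrix.trace, Matrix.mul_apply, Matrix.diag, Matrix.transpose_apply]
  have h1 : A a b ^ 2 ≤ ∑ j, A j b * A j b := by
    rw [pow_two]
    exact Finset.single_le_sum (f := fun j => A j b * A j b) (fun j _ => mul_self_nonneg _)
      (Finset.mem_univ a)
  exact h1.trans (Finset.single_le_sum (f := fun i => ∑ j, A j i * A j i)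
    (fun i _ => Finset.sum_nonneg fun j _ => mul_self_nonneg _) (Finset.mem_univ b))

end LyapunovOperator

/-! ### Limits of block-scaled matrices. -/

section ScaledLimits

variable {m : ℕ} {Q R : Matrix (Fin m) (Fin m) ℝ} (h : IsComplProj Q R) {ι : Type*} {l : Filter ι}
include h

/-- The scaling `T` fixes `A`, and `T (G - A) T = (s T) (s⁻² (G - A)) (s T)` with `s T → Q`. -/
theorem IsComplProj.tendsto_scaled {A Δ : Matrix (Fin m) (Fin m) ℝ} (hQA : Q * A = 0)
    (hAQ : A * Q = 0) {s : ι → ℝ} (hs : ∀ k, 0 < s k) (hs0 : Tendsto s l (𝓝 0))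
    {G : ι → Matrix (Fin m) (Fin m) ℝ}
    (hG : Tendsto (fun k => (s k ^ 2)⁻¹ • (G k - A)) l (𝓝 Δ)) :
    Tendsto (fun k => blockScale Q R (s k)⁻¹ * G k * blockScale Q R (s k)⁻¹) l
      (𝓝 (Q * Δ * Q + A)) := by
  have h1 : ∀ k, s k • blockScale Q R (s k)⁻¹ = Q + s k • R := fun k => by
    rw [blockScale, smul_add, smul_smul, mul_inv_cancel₀ (hs k).ne', one_smul]
  have h2 : Tendsto (fun k => Q + s k • R) l (𝓝 Q) := by
    simpa using (tendsto_const_nhds (x := Q)).add (hs0.smul_const R)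
  have hRA : R * A = A := by
    have : (Q + R) * A = A := by rw [h.add_eq, one_mul]
    rwa [add_mul, hQA, zero_add] at this
  have hAR : A * R = A := by
    have : A * (Q + R) = A := by rw [h.add_eq, mul_one]
    rwa [mul_add, hAQ, zero_add] at this
  refine (((h2.mul hG).mul h2).add_const A).congr fun k => ?_
  have hTA : blockScale Q R (s k)⁻¹ * A * blockScale Q R (s k)⁻¹ = A := by
    rw [blockScale, add_mul, smul_mul_assoc, hQA, smul_zero, zero_add, hRA, mul_add,
      mul_smul_comm, hAQ, smul_zero, zero_add, hAR]
  have hs' := (hs k).ne'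
  rw [← h1]
  simp only [smul_mul_assoc, mul_smul_comm, smul_smul, mul_sub, sub_mul, hTA]
  rw [← smul_sub, smul_smul, show s k * (s k ^ 2)⁻¹ * s k = 1 by field_simp, one_smul,
    sub_add_cancel]

/-- Changing the scale by a factor tending to `1` does not change the limit. -/
theorem IsComplProj.tendsto_rescale {M₀ : Matrix (Fin m) (Fin m) ℝ} {s s' : ι → ℝ}
    (hs : ∀ k, 0 < s k) (hs' : ∀ k, 0 < s' k) (hratio : Tendsto (fun k => s' k / s k) l (𝓝 1))
    {G : ι → Matrix (Fin m) (Fin m) ℝ}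
    (hM : Tendsto (fun k => blockScale Q R (s k)⁻¹ * G k * blockScale Q R (s k)⁻¹) l (𝓝 M₀)) :
    Tendsto (fun k => blockScale Q R (s' k)⁻¹ * G k * blockScale Q R (s' k)⁻¹) l (𝓝 M₀) := by
  have h1 : Tendsto (fun k => blockScale Q R (s' k / s k)⁻¹) l (𝓝 1) := by
    have := ((hratio.inv₀ one_ne_zero).smul_const Q).add_const R
    simpa [blockScale, h.add_eq] using this
  have h2 := (h1.mul hM).mul h1
  rw [one_mul, mul_one] at h2
  refine h2.congr fun k => ?_
  have e : (s' k / s k)⁻¹ * (s k)⁻¹ = (s' k)⁻¹ := by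
    have := (hs k).ne'
    have := (hs' k).ne'
    field_simp
  have e1 : blockScale Q R (s' k / s k)⁻¹ * blockScale Q R (s k)⁻¹ = blockScale Q R (s' k)⁻¹ := by
    rw [h.blockScale_mul, e]
  have e2 : blockScale Q R (s k)⁻¹ * blockScale Q R (s' k / s k)⁻¹ = blockScale Q R (s' k)⁻¹ := by
    rw [h.blockScale_mul, mul_comm, e]
  calc _ = (blockScale Q R (s' k / s k)⁻¹ * blockScale Q R (s k)⁻¹) * G k *
        (blockScale Q R (s k)⁻¹ * blockScale Q R (s' k / s k)⁻¹) := by simp only [mul_assoc]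
    _ = _ := by rw [e1, e2]

theorem IsComplProj.posDef_of_scaled {G : Matrix (Fin m) (Fin m) ℝ} {c : ℝ} (hc : c ≠ 0)
    (hM : (blockScale Q R c⁻¹ * G * blockScale Q R c⁻¹).PosDef) : G.PosDef := by
  have h1 : IsUnit (blockScale Q R c) :=
    IsUnit.of_mul_eq_one _ (h.blockScale_mul_blockScale_inv hc)
  have h2 := hM.conjTranspose_mul_mul_same (B := blockScale Q R c)
    (Matrix.mulVec_injective_iff_isUnit.2 h1)
  rw [conjTranspose_eq_transpose_of_trivial, h.blockScale_transpose] at h2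
  have h3 : blockScale Q R c * (blockScale Q R c⁻¹ * G * blockScale Q R c⁻¹) * blockScale Q R c
      = G := by
    calc _ = (blockScale Q R c * blockScale Q R c⁻¹) * G *
          (blockScale Q R c⁻¹ * blockScale Q R c) := by simp only [mul_assoc]
      _ = G := by
        rw [h.blockScale_mul_blockScale_inv hc, h.blockScale_inv_mul_blockScale hc, one_mul,
          mul_one]
  rwa [h3] at h2

end ScaledLimits

namespace NSDP

/-! ### Families of points approaching `x*` along `ξ*`. -/

section Families

variable {n m s p r : ℕ} {P : NSDP n m s} {xs ξ : EuclideanSpace ℝ (Fin n)}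
  {E : Matrix (Fin m) (Fin p) ℝ} {F : Matrix (Fin m) (Fin r) ℝ} {Ya : SymMat m}
  {za : EuclideanSpace ℝ (Fin s)}

/-- `Y ↦ (∂G(x)/∂xᵢ • Y)ᵢ` on all square matrices. -/
noncomputable def adjMat (P : NSDP n m s) (x : EuclideanSpace ℝ (Fin n)) :
    Matrix (Fin m) (Fin m) ℝ →ₗ[ℝ] EuclideanSpace ℝ (Fin n) where
  toFun Y := WithLp.toLp 2 fun i => ((P.partialG i x : Matrix (Fin m) (Fin m) ℝ) * Y).trace
  map_add' Y Z := by
    ext i; simp [mul_add]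
  map_smul' c Y := by
    ext i; simp

theorem adjMat_coe (x : EuclideanSpace ℝ (Fin n)) (Y : SymMat m) :
    P.adjMat x (Y : Matrix (Fin m) (Fin m) ℝ) = P.adjG x Y := rfl

theorem tendsto_adjMat (P : NSDP n m s) {ι : Type*} {l : Filter ι}
    {x : ι → EuclideanSpace ℝ (Fin n)}
    {Y : ι → Matrix (Fin m) (Fin m) ℝ} {x₀ : EuclideanSpace ℝ (Fin n)}
    {Y₀ : Matrix (Fin m) (Fin m) ℝ} (hx : Tendsto x l (𝓝 x₀)) (hY : Tendsto Y l (𝓝 Y₀)) :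
    Tendsto (fun k => P.adjMat (x k) (Y k)) l (𝓝 (P.adjMat x₀ Y₀)) := by
  refine ((PiLp.continuous_toLp 2 _).tendsto _).comp (tendsto_pi_nhds.2 fun i => ?_)
  have h1 : Tendsto (fun k => (P.partialG i (x k) : Matrix (Fin m) (Fin m) ℝ)) l
      (𝓝 (P.partialG i x₀ : Matrix (Fin m) (Fin m) ℝ)) :=
    ((P.continuous_partialG i).tendsto x₀).comp hx
  exact tendsto_trace (h1.mul hY)

theorem eventually_rank_gradH {ι : Type*} (l : Ultrafilter ι) {x : ι → EuclideanSpace ℝ (Fin n)}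
    (hx : Tendsto x l (𝓝 xs)) (hrank : (P.gradH xs).rank = s) :
    ∀ᶠ k in l, (P.gradH (x k)).rank = s := by
  by_contra hcon
  rw [← Ultrafilter.eventually_not] at hcon
  have h1 : ∀ k, ∃ z, ¬ (P.gradH (x k)).rank = s →
      toEuclideanLin (P.gradH (x k)) z = 0 ∧ ‖z‖ = 1 := by
    intro k
    by_cases hk : (P.gradH (x k)).rank = s
    · exact ⟨0, fun h => absurd hk h⟩
    · have hk' := hk
      rw [injective_toEuclideanLin_iff] at hk'
      push Not at hk'
      obtain ⟨z, hz, hz0⟩ := hk'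
      refine ⟨‖z‖⁻¹ • z, fun _ => ⟨by rw [map_smul, hz, smul_zero], ?_⟩⟩
      rw [norm_smul, norm_inv, norm_norm, inv_mul_cancel₀ (norm_ne_zero_iff.2 hz0)]
  choose z hz using h1
  have hH : Tendsto (fun k => P.gradH (x k)) l (𝓝 (P.gradH xs)) :=
    (P.continuous_gradH.tendsto xs).comp hx
  -- The limit of `∇h` is injective, so unit kernel vectors would have to tend to zero.
  have hz0 : Tendsto z l (𝓝 0) := by
    refine l.tendsto_of_tendsto_apply (T := fun k => toEuclideanLin (P.gradH (x k)))
      (T₀ := toEuclideanLin (P.gradH xs)) (fun u v hu => tendsto_toEuclideanLin hH hu)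
      ((injective_toEuclideanLin_iff _).1 hrank) ?_
    rw [map_zero]
    exact tendsto_const_nhds.congr' (hcon.mono fun k hk => (hz k hk).1.symm)
  have h2 := tendsto_nhds_unique hz0.norm
    (tendsto_const_nhds.congr' (hcon.mono fun k hk => (hz k hk).2.symm))
  simp at h2

variable (hEF : IsEigenFrame (P.G xs : Matrix (Fin m) (Fin m) ℝ) E F)
  (hYa : P.IsAnalyticCenter xs E Ya za) (hSC : P.StrictComplementarity xs)
include hEF hYa hSC

theorem posDef_add_moorePenrose : ((Ya : Matrix (Fin m) (Fin m) ℝ)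
    + moorePenrose (P.G xs : Matrix (Fin m) (Fin m) ℝ)).PosDef :=
  hEF.posDef_add_moorePenrose hYa.1.2.2.2.1 (hYa.posDef hEF hSC)

variable (hξ : P.IsCentralDirection xs E Ya za ξ)
  {ι : Type*} (l : Ultrafilter ι) {x : ι → EuclideanSpace ℝ (Fin n)} {τ : ι → ℝ}
  (hτ : ∀ k, 0 < τ k) (hτ0 : Tendsto τ l (𝓝 0))
  (hx : Tendsto (fun k => (τ k)⁻¹ • (x k - xs)) l (𝓝 ξ))

omit hEF hYa hSC in
include hτ hτ0 hx in
theorem tendsto_of_tangent : Tendsto x l (𝓝 xs) := by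
  have h := (hτ0.smul hx).add_const xs
  rw [zero_smul, zero_add] at h
  refine h.congr fun k => ?_
  rw [smul_smul, mul_inv_cancel₀ (hτ k).ne', one_smul, sub_add_cancel]

include hξ hτ hτ0 hx

theorem tendsto_scaled_G_tangent :
    Tendsto (fun k => blockScale (E * Eᵀ) (F * Fᵀ) (√(τ k))⁻¹
      * (P.G (x k) : Matrix (Fin m) (Fin m) ℝ) * blockScale (E * Eᵀ) (F * Fᵀ) (√(τ k))⁻¹) l
      (𝓝 ((Ya : Matrix (Fin m) (Fin m) ℝ)
        + moorePenrose (P.G xs : Matrix (Fin m) (Fin m) ℝ))⁻¹) := by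
  obtain ⟨X, -, heq, -⟩ := hξ
  have hinv := hEF.inv_eq_of_central (X := (X : Matrix (Fin m) (Fin m) ℝ)) hYa.1.2.2.2.1
    hYa.1.2.1 (hYa.posDef hEF hSC) heq
  rw [← hinv]
  have hG := P.tendsto_inv_smul_sub_G (tendsto_of_tangent l hτ hτ0 hx) hx
  refine hEF.isComplProj.tendsto_scaled hEF.mul_left_eq_zero.1 hEF.mul_left_eq_zero.2
    (fun k => Real.sqrt_pos.2 (hτ k)) ?_ ?_
  · simpa using hτ0.sqrt
  · simpa only [fun k => Real.sq_sqrt (hτ k).le] using hG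

theorem eventually_posDef_G : ∀ᶠ k in l, (P.G (x k) : Matrix (Fin m) (Fin m) ℝ).PosDef := by
  have h1 := tendsto_scaled_G_tangent hEF hYa hSC hξ l hτ hτ0 hx
  have h2 := l.eventually_posDef h1 (fun k => by
    have hGs : (P.G (x k) : Matrix (Fin m) (Fin m) ℝ)ᵀ = P.G (x k) := (P.G (x k)).2
    simp only [transpose_mul, hEF.isComplProj.blockScale_transpose, hGs, mul_assoc])
    (posDef_add_moorePenrose hEF hYa hSC).inv
  exact h2.mono fun k hk => hEF.isComplProj.posDef_of_scaled (Real.sqrt_pos.2 (hτ k)).ne' hk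

end Families

end NSDP

namespace NSDP

/-! ### Convergence of near-central multipliers to the analytic center. -/

section Multipliers

variable {n m s p r : ℕ} {P : NSDP n m s} {xs ξ : EuclideanSpace ℝ (Fin n)}
  {E : Matrix (Fin m) (Fin p) ℝ} {F : Matrix (Fin m) (Fin r) ℝ} {Ya : SymMat m}
  {za : EuclideanSpace ℝ (Fin s)} {γ₁ γ₂ : ℝ}

/-- The bound by `γ₁ μ` keeps the residual divided by `μ` bounded entrywise, so it converges along
the ultrafilter. -/
theorem exists_tendsto_residual {ι : Type*} (l : Ultrafilter ι) {x : ι → EuclideanSpace ℝ (Fin n)}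
    {μ : ι → ℝ} {Y : ι → SymMat m} {z : ι → EuclideanSpace ℝ (Fin s)} (hμ : ∀ k, 0 < μ k)
    (hN : ∀ k, P.NearCentral γ₁ γ₂ (μ k) (x k) (Y k) (z k)) :
    ∃ (B : ι → Matrix (Fin m) (Fin m) ℝ) (B₀ : Matrix (Fin m) (Fin m) ℝ), Tendsto B l (𝓝 B₀) ∧
      ∀ k, (Y k : Matrix (Fin m) (Fin m) ℝ)
        = μ k • (P.G (x k) : Matrix (Fin m) (Fin m) ℝ)⁻¹ + μ k • B k := by
  set B : ι → Matrix (Fin m) (Fin m) ℝ := fun k => (μ k)⁻¹ •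
    ((Y k : Matrix (Fin m) (Fin m) ℝ) - μ k • (P.G (x k) : Matrix (Fin m) (Fin m) ℝ)⁻¹) with hB
  have h1 : ∀ a b, ∃ c, Tendsto (fun k => B k a b) l (𝓝 c) := fun a b => by
    refine l.exists_tendsto_of_norm_le (C := γ₁) (Eventually.of_forall fun k => ?_)
    have h2 := (abs_apply_le_frobNorm _ a b).trans (hN k).1
    simp only [hB, Matrix.smul_apply, smul_eq_mul, Real.norm_eq_abs, abs_mul, abs_inv,
      abs_of_pos (hμ k)]
    rw [inv_mul_le_iff₀ (hμ k), mul_comm (μ k)]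
    exact h2
  choose B₀ hB₀ using h1
  refine ⟨B, Matrix.of B₀, tendsto_pi_nhds.2 fun a => tendsto_pi_nhds.2 fun b => hB₀ a b,
    fun k => ?_⟩
  simp only [hB, smul_smul, mul_inv_cancel₀ (hμ k).ne', one_smul, add_sub_cancel]

theorem tendsto_gradL_zero {ι : Type*} {l : Filter ι} {x : ι → EuclideanSpace ℝ (Fin n)}
    {μ : ι → ℝ} {Y : ι → SymMat m} {z : ι → EuclideanSpace ℝ (Fin s)} (hμ0 : Tendsto μ l (𝓝 0))
    (hN : ∀ k, P.NearCentral γ₁ γ₂ (μ k) (x k) (Y k) (z k)) :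
    Tendsto (fun k => P.gradL (x k) (Y k) (z k)) l (𝓝 0) := by
  refine squeeze_zero_norm (fun k => (hN k).2) ?_
  simpa using hμ0.const_mul γ₂

variable (hEF : IsEigenFrame (P.G xs : Matrix (Fin m) (Fin m) ℝ) E F)
  (hYa : P.IsAnalyticCenter xs E Ya za) (hSC : P.StrictComplementarity xs) (hMFCQ : P.MFCQ xs)
  (hξ : P.IsCentralDirection xs E Ya za ξ)
  {ι : Type*} (l : Ultrafilter ι) {x : ι → EuclideanSpace ℝ (Fin n)} {τ μ : ι → ℝ}
  {Y : ι → SymMat m} {z : ι → EuclideanSpace ℝ (Fin s)}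
  (hτ : ∀ k, 0 < τ k) (hτ0 : Tendsto τ l (𝓝 0))
  (hx : Tendsto (fun k => (τ k)⁻¹ • (x k - xs)) l (𝓝 ξ))
  (hμ : ∀ k, 0 < μ k) (hμ0 : Tendsto μ l (𝓝 0))
  (hN : ∀ k, P.NearCentral γ₁ γ₂ (μ k) (x k) (Y k) (z k))

include hYa in
theorem gradL_analyticCenter :
    toEuclideanLin (P.gradH xs) za - P.adjG xs Ya = -gradient P.f xs := by
  have h := hYa.1.1
  rw [gradL_eq] at h
  rw [eq_neg_iff_add_eq_zero, ← h]
  abel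

include hEF hYa hSC in
-- The projection `Q` annihilates `A†` and fixes `Ya`; this identifies the limit of `τ G⁻¹`.
theorem proj_inv_proj : E * Eᵀ * ((Ya : Matrix (Fin m) (Fin m) ℝ)
    + moorePenrose (P.G xs : Matrix (Fin m) (Fin m) ℝ))⁻¹⁻¹ * (E * Eᵀ) = Ya := by
  have hJ := posDef_add_moorePenrose hEF hYa hSC
  obtain ⟨y1, y2⟩ := hEF.proj_mul_of_complementary hYa.1.2.2.2.1 hYa.1.2.1
  rw [nonsing_inv_nonsing_inv _ ((isUnit_iff_isUnit_det _).1 hJ.isUnit), mul_add, y1,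
    hEF.moorePenrose_data.2.2.2.1, add_zero, y2]

include hEF hYa hSC hMFCQ hξ hτ hτ0 hx hμ hμ0 hN

/-- If the analytic center is nonzero, the parameter of a near-central point is asymptotically
determined by the position of its `x`-component. -/
theorem tendsto_ratio (hYa0 : (Ya : Matrix (Fin m) (Fin m) ℝ) ≠ 0) :
    Tendsto (fun k => μ k / τ k) l (𝓝 1) := by
  have hxs := tendsto_of_tangent l hτ hτ0 hx
  have hM := tendsto_scaled_G_tangent hEF hYa hSC hξ l hτ hτ0 hx
  have hJ := posDef_add_moorePenrose hEF hYa hSC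
  have hinv := hEF.isComplProj.tendsto_sq_smul_inv (fun k => Real.sqrt_pos.2 (hτ k))
    (by simpa using hτ0.sqrt) hM hJ.inv.isUnit
  rw [proj_inv_proj hEF hYa hSC] at hinv
  simp only [fun k => Real.sq_sqrt (hτ k).le] at hinv
  have hA := P.tendsto_adjMat hxs hinv
  have hH : Tendsto (fun k => P.gradH (x k)) l (𝓝 (P.gradH xs)) :=
    (P.continuous_gradH.tendsto xs).comp hxs
  obtain ⟨B, B₀, hB, hY⟩ := P.exists_tendsto_residual l hμ hN
  -- Near-stationarity is read as a linear equation for the pair `(μ / τ, z)`: the operator is `(t,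
  -- w) ↦ ∇h w - t a`, with `a` the adjoint derivative applied to `τ G⁻¹`, and the right-hand side
  -- tends to `-∇f(x*)`.
  set T : (A : Matrix (Fin n) (Fin s) ℝ) → (a : EuclideanSpace ℝ (Fin n)) →
      (ℝ × EuclideanSpace ℝ (Fin s) →ₗ[ℝ] EuclideanSpace ℝ (Fin n)) := fun A a =>
    (toEuclideanLin A).comp (LinearMap.snd ℝ ℝ _)
      - (LinearMap.toSpanSingleton ℝ _ a).comp (LinearMap.fst ℝ ℝ _) with hT
  have hTapply : ∀ A a q, T A a q = toEuclideanLin A q.2 - q.1 • a := fun A a q => by simp [hT]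
  have hlim : Tendsto (fun k => ((μ k / τ k, z k) : ℝ × EuclideanSpace ℝ (Fin s))) l
      (𝓝 (1, za)) := by
    refine l.tendsto_of_tendsto_apply
      (T := fun k => T (P.gradH (x k)) (P.adjMat (x k) (τ k • (P.G (x k)).1⁻¹)))
      (T₀ := T (P.gradH xs) (P.adjMat xs Ya)) ?_ ?_ ?_
    · intro u v hu
      simp only [hTapply]
      have hu1 : Tendsto (fun k => (u k).1) l (𝓝 v.1) := (continuous_fst.tendsto v).comp hu
      have hu2 : Tendsto (fun k => (u k).2) l (𝓝 v.2) := (continuous_snd.tendsto v).comp hu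
      exact (tendsto_toEuclideanLin hH hu2).sub (hu1.smul hA)
    · rintro ⟨t, w⟩ hw
      rw [hTapply, sub_eq_zero] at hw
      obtain ⟨-, -, hrank, d, hd, hd0⟩ := hMFCQ
      -- Pairing with the MFCQ direction removes `∇h`. Because `G(x*) • Ya = 0`, the coefficient of
      -- `t` equals `(G(x*) + ΔG(x*; d)) • Ya`, which is nonzero for `Ya ≠ 0`.
      have h1 : inner ℝ d (t • P.adjMat xs Ya) = 0 := by
        rw [← hw, inner_toEuclideanLin, hd0, inner_zero_left]
      rw [adjMat_coe, inner_smul_right, inner_adjG] at h1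
      have h2 : symBullet (P.deltaG xs d) Ya ≠ 0 := by
        intro h0
        apply hYa0
        refine hd.eq_zero_of_trace_mul hYa.1.2.2.2.1 ?_
        have h3 := hYa.1.2.1
        rw [symBullet] at h0 h3
        rw [Submodule.coe_add, add_mul, trace_add, h0, add_zero]
        exact h3
      have ht : t = 0 := (mul_eq_zero.1 h1).resolve_right h2
      subst ht
      rw [zero_smul] at hw
      rw [(injective_toEuclideanLin_iff _).1 hrank w hw]
      rfl
    · have h1 : ∀ k, T (P.gradH (x k)) (P.adjMat (x k) (τ k • (P.G (x k)).1⁻¹)) (μ k / τ k, z k)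
          = P.gradL (x k) (Y k) (z k) - gradient P.f (x k) + μ k • P.adjMat (x k) (B k) := by
        intro k
        rw [hTapply, gradL_eq, ← adjMat_coe, hY k, map_add, map_smul, map_smul, map_smul, smul_smul,
          div_mul_cancel₀ _ (hτ k).ne']
        abel
      simp only [h1]
      have h2 : T (P.gradH xs) (P.adjMat xs Ya) (1, za) = 0 - gradient P.f xs
          + (0 : ℝ) • P.adjMat xs B₀ := by
        rw [hTapply, one_smul, adjMat_coe, gradL_analyticCenter hYa, zero_smul, zero_sub, add_zero]
      rw [h2]
      exact ((tendsto_gradL_zero hμ0 hN).sub ((P.continuous_gradient_f.tendsto xs).comp hxs)).add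
        (hμ0.smul (P.tendsto_adjMat hxs hB))
  exact (continuous_fst.tendsto _).comp hlim

/-- Since `μ / τ → 1`, the scale `√τ` may be replaced by `√μ`. If `Ya = 0`, no ratio is available,
but then `E` has no columns and the scaling does not depend on its parameter. -/
theorem tendsto_scaled_G_parameter :
    Tendsto (fun k => blockScale (E * Eᵀ) (F * Fᵀ) (√(μ k))⁻¹
      * (P.G (x k) : Matrix (Fin m) (Fin m) ℝ) * blockScale (E * Eᵀ) (F * Fᵀ) (√(μ k))⁻¹) l
      (𝓝 ((Ya : Matrix (Fin m) (Fin m) ℝ)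
        + moorePenrose (P.G xs : Matrix (Fin m) (Fin m) ℝ))⁻¹) := by
  have hM := tendsto_scaled_G_tangent hEF hYa hSC hξ l hτ hτ0 hx
  by_cases hYa0 : (Ya : Matrix (Fin m) (Fin m) ℝ) = 0
  · have h1 := hYa.posDef hEF hSC
    rw [hYa0, Matrix.mul_zero, Matrix.zero_mul] at h1
    have h2 := h1.isUnit
    rw [isUnit_zero_iff] at h2
    have hE : E = 0 := by rw [← Matrix.mul_one E, ← h2, Matrix.mul_zero]
    have h3 : ∀ c d, blockScale (E * Eᵀ) (F * Fᵀ) c = blockScale (E * Eᵀ) (F * Fᵀ) d := by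
      intro c d
      simp [blockScale, hE]
    refine hM.congr fun k => ?_
    rw [h3 _ (√(μ k))⁻¹]
  · have hr := tendsto_ratio hEF hYa hSC hMFCQ hξ l hτ hτ0 hx hμ hμ0 hN hYa0
    refine hEF.isComplProj.tendsto_rescale (fun k => Real.sqrt_pos.2 (hτ k))
      (fun k => Real.sqrt_pos.2 (hμ k)) ?_ hM
    have := hr.sqrt
    rw [Real.sqrt_one] at this
    exact this.congr fun k => Real.sqrt_div (hμ k).le _

/-- At scale `√μ` the matrices `μ G⁻¹` tend to `Ya`, and `Y` differs from them by `O(μ)`. Full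
column rank of `∇h(x*)` then determines the limit of `z` from stationarity. -/
theorem tendsto_multiplier :
    Tendsto (fun k => (Y k : Matrix (Fin m) (Fin m) ℝ)) l (𝓝 (Ya : Matrix (Fin m) (Fin m) ℝ)) ∧
      Tendsto z l (𝓝 za) := by
  have hxs := tendsto_of_tangent l hτ hτ0 hx
  have hM := tendsto_scaled_G_parameter hEF hYa hSC hMFCQ hξ l hτ hτ0 hx hμ hμ0 hN
  have hJ := posDef_add_moorePenrose hEF hYa hSC
  have hinv := hEF.isComplProj.tendsto_sq_smul_inv (fun k => Real.sqrt_pos.2 (hμ k))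
    (by simpa using hμ0.sqrt) hM hJ.inv.isUnit
  rw [proj_inv_proj hEF hYa hSC] at hinv
  simp only [fun k => Real.sq_sqrt (hμ k).le] at hinv
  obtain ⟨B, B₀, hB, hY⟩ := P.exists_tendsto_residual l hμ hN
  have hYlim : Tendsto (fun k => (Y k : Matrix (Fin m) (Fin m) ℝ)) l
      (𝓝 (Ya : Matrix (Fin m) (Fin m) ℝ)) := by
    have := hinv.add (hμ0.smul hB)
    rw [zero_smul, add_zero] at this
    exact this.congr fun k => (hY k).symm
  refine ⟨hYlim, ?_⟩
  have hH : Tendsto (fun k => P.gradH (x k)) l (𝓝 (P.gradH xs)) :=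
    (P.continuous_gradH.tendsto xs).comp hxs
  refine l.tendsto_of_tendsto_apply (T := fun k => toEuclideanLin (P.gradH (x k)))
      (T₀ := toEuclideanLin (P.gradH xs)) (fun u v hu => tendsto_toEuclideanLin hH hu)
      ((injective_toEuclideanLin_iff _).1 hMFCQ.2.2.1) ?_
  have h1 := ((tendsto_gradL_zero hμ0 hN).sub
    ((P.continuous_gradient_f.tendsto xs).comp hxs)).add (P.tendsto_adjMat hxs hYlim)
  have h2 : 0 - gradient P.f xs + P.adjMat xs Ya = toEuclideanLin (P.gradH xs) za := by
    rw [zero_sub, ← gradL_analyticCenter hYa, adjMat_coe]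
    abel
  rw [h2] at h1
  refine h1.congr fun k => ?_
  simp only [gradL_eq, adjMat_coe, Function.comp_apply]
  abel

end Multipliers

/-! ### The second-order condition in the limit. -/

section Positivity

variable {n m s p r : ℕ} {P : NSDP n m s} {xs ξ : EuclideanSpace ℝ (Fin n)}
  {E : Matrix (Fin m) (Fin p) ℝ} {F : Matrix (Fin m) (Fin r) ℝ} {Ya : SymMat m}
  {za : EuclideanSpace ℝ (Fin s)} {γ₁ γ₂ : ℝ}

theorem inner_sigmaMat (x d : EuclideanSpace ℝ (Fin n)) (Y : SymMat m) :
    inner ℝ d (toEuclideanLin (P.sigmaMat x Y) d)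
      = 2 * ((Y : Matrix (Fin m) (Fin m) ℝ) * ((P.deltaG x d : Matrix (Fin m) (Fin m) ℝ) *
        moorePenrose (P.G x : Matrix (Fin m) (Fin m) ℝ) *
        (P.deltaG x d : Matrix (Fin m) (Fin m) ℝ))).trace := by
  simp only [PiLp.inner_apply, toLpLin_apply, Matrix.mulVec, dotProduct, sigmaMat, of_apply,
    deltaG, LinearMap.coe_mk, AddHom.coe_mk, Submodule.coe_sum, Submodule.coe_smul,
      RCLike.inner_apply,
    conj_trivial]
  simp only [Finset.sum_mul, Finset.mul_sum, Matrix.trace_sum, smul_mul_assoc, mul_smul_comm,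
    trace_smul, smul_eq_mul]
  rw [Finset.sum_comm]
  refine Finset.sum_congr rfl fun i _ => Finset.sum_congr rfl fun j _ => ?_
  ring

/-- The limit of the barrier term dominates the sigma term. -/
theorem two_mul_trace_le {Y V W Q R N : Matrix (Fin m) (Fin m) ℝ} (hQ : IsComplProj Q R)
    (hY : Y.PosSemidef) (hQY : Q * Y = Y) (hYQ : Y * Q = Y) (hQN : Q * N = 0) (hNQ : N * Q = 0)
    (hW : Wᵀ = W) (h1 : Q * W * R = Q * V * R) (h2 : R * W * Q = R * V * Q) (h3 : R * W * R = 0) :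
    2 * (Y * (V * N * V)).trace ≤ (W * (Y + N) * W * (Y + N)).trace := by
  have hRN : R * N = N := by
    have : (Q + R) * N = N := by rw [hQ.add_eq, one_mul]
    rwa [add_mul, hQN, zero_add] at this
  have hNR : N * R = N := by
    have : N * (Q + R) = N := by rw [hQ.add_eq, mul_one]
    rwa [mul_add, hNQ, zero_add] at this
  -- As `Y` lives in the `Q` corner and `N` in the `R` corner, mixed products see only off-diagonal
  -- blocks, where `W` and `V` agree.
  have hYWN : Y * W * N = Y * V * N := by
    calc Y * W * N = Y * (Q * W * R) * N := by
          rw [← mul_assoc Y, ← mul_assoc Y, hYQ, mul_assoc (Y * W), hRN]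
      _ = Y * V * N := by
          rw [h1, ← mul_assoc Y, ← mul_assoc Y, hYQ, mul_assoc (Y * V), hRN]
  have hNWY : N * W * Y = N * V * Y := by
    calc N * W * Y = N * (R * W * Q) * Y := by
          rw [← mul_assoc N, ← mul_assoc N, hNR, mul_assoc (N * W), hQY]
      _ = N * V * Y := by
          rw [h2, ← mul_assoc N, ← mul_assoc N, hNR, mul_assoc (N * V), hQY]
  have hNWN : N * W * N = 0 := by
    calc N * W * N = N * (R * W * R) * N := by
          rw [← mul_assoc N, ← mul_assoc N, hNR, mul_assoc (N * W), hRN]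
      _ = 0 := by rw [h3, mul_zero, zero_mul]
  have hYNY : (Y * (W * N * W)).trace = (Y * (V * N * V)).trace := by
    have k1 : (Y * (W * N * W)).trace = (Y * V * N * W).trace := by
      rw [← mul_assoc, ← mul_assoc, hYWN]
    have k2 : (Y * V * N * W).trace = (N * W * Y * V).trace := by
      rw [mul_assoc (Y * V), trace_mul_comm]
      simp only [mul_assoc]
    have k3 : (N * W * Y * V).trace = (Y * (V * N * V)).trace := by
      rw [hNWY, mul_assoc (N * V), trace_mul_comm]
      simp only [mul_assoc]
    rw [k1, k2, k3]
  have hexp : (W * (Y + N) * W * (Y + N)).trace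
      = (W * Y * W * Y).trace + 2 * (Y * (W * N * W)).trace := by
    have k1 : (W * N * W * N).trace = 0 := by
      rw [mul_assoc W, mul_assoc W, hNWN, mul_zero, trace_zero]
    have k2 : (W * Y * W * N).trace = (Y * (W * N * W)).trace := by
      rw [mul_assoc W, mul_assoc W, trace_mul_comm]
      simp only [mul_assoc]
    have k3 : (W * N * W * Y).trace = (Y * (W * N * W)).trace := trace_mul_comm _ _
    simp only [mul_add, add_mul, trace_add, k1, k2, k3]
    ring
  rw [hexp, hYNY]
  -- The only slack in the inequality is the nonnegative term `tr(W Y W Y)`.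
  linarith [hY.trace_mul_mul_mul_nonneg hW]

/-- The limit direction is nonzero and critical, and the limit inequality bounds Hessian plus
barrier term by zero. As the barrier limit dominates the sigma term, this contradicts the
second-order condition at the analytic center. -/
theorem reducedHessian_pos_of_family
    (hEF : IsEigenFrame (P.G xs : Matrix (Fin m) (Fin m) ℝ) E F)
    (hYa : P.IsAnalyticCenter xs E Ya za) (hSC : P.StrictComplementarity xs)
    (hSSOSC : P.SSOSC xs E) (hMFCQ : P.MFCQ xs) (hξ : P.IsCentralDirection xs E Ya za ξ)
    {ι : Type*} (l : Ultrafilter ι) {x d : ι → EuclideanSpace ℝ (Fin n)} {τ μ : ι → ℝ}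
    {Y : ι → SymMat m} {z : ι → EuclideanSpace ℝ (Fin s)}
    (hτ : ∀ k, 0 < τ k) (hτ0 : Tendsto τ l (𝓝 0))
    (hx : Tendsto (fun k => (τ k)⁻¹ • (x k - xs)) l (𝓝 ξ))
    (hμ : ∀ k, 0 < μ k) (hμ0 : Tendsto μ l (𝓝 0))
    (hN : ∀ k, P.NearCentral γ₁ γ₂ (μ k) (x k) (Y k) (z k))
    (hG : ∀ k, (P.G (x k) : Matrix (Fin m) (Fin m) ℝ).PosDef)
    (hd1 : ∀ k, ‖d k‖ = 1) (hd : ∀ k, toEuclideanLin (P.gradH (x k))ᵀ (d k) = 0)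
    (hle : ∀ k, inner ℝ (d k) (toEuclideanLin (P.hessL (x k) (Y k) (z k)) (d k)) +
      symBullet (P.deltaG (x k) (d k)) (Ring.inverse (lyapOp (P.G (x k)))
        (lyapOp (Y k) (P.deltaG (x k) (d k)))) ≤ 0) : False := by
  have hxs := tendsto_of_tangent l hτ hτ0 hx
  have hM := tendsto_scaled_G_parameter hEF hYa hSC hMFCQ hξ l hτ hτ0 hx hμ hμ0 hN
  have hJ := posDef_add_moorePenrose hEF hYa hSC
  obtain ⟨hYlim, hzlim⟩ := tendsto_multiplier hEF hYa hSC hMFCQ hξ l hτ hτ0 hx hμ hμ0 hN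
  obtain ⟨B, B₀, hB, hYB⟩ := P.exists_tendsto_residual l hμ hN
  obtain ⟨d₀, hd₀⟩ := l.exists_tendsto_of_norm_le (Eventually.of_forall fun k => (hd1 k).le)
  have hd₀0 : d₀ ≠ 0 := by
    rintro rfl
    have := tendsto_nhds_unique hd₀.norm (tendsto_const_nhds.congr fun k => (hd1 k).symm)
    simp at this
  have hH : Tendsto (fun k => (P.gradH (x k))ᵀ) l (𝓝 (P.gradH xs)ᵀ) :=
    (P.continuous_gradH.matrix_transpose.tendsto xs).comp hxs
  have hdH : toEuclideanLin (P.gradH xs)ᵀ d₀ = 0 :=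
    tendsto_nhds_unique (tendsto_toEuclideanLin hH hd₀)
      (tendsto_const_nhds.congr fun k => (hd k).symm)
  have hVlim := P.tendsto_deltaG hxs hd₀
  have ha := hd₀.inner (𝕜 := ℝ) (tendsto_toEuclideanLin (P.tendsto_hessL hxs hYlim hzlim) hd₀)
  choose Z hZ hZU using fun k => exists_trace_lyapOp_inverse (hG k) (P.deltaG (x k) (d k))
  obtain ⟨hQVQ, W, hWs, hW1, hW2, hW3, hW4⟩ := exists_limit_of_barrier_nonpos
    hEF.isComplProj l (fun k => Real.sqrt_pos.2 (hμ k)) (by simpa using hμ0.sqrt) hM hJ.inv hVlim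
    (fun k => (Z k).2) hZ (fun k => (P.deltaG (x k) (d k)).2)
    (Eventually.of_forall fun k => (hG k).isUnit) hB ha
    (Y := fun k => (Y k : Matrix (Fin m) (Fin m) ℝ))
    (fun k => by rw [Real.sq_sqrt (hμ k).le]; exact hYB k)
    (Eventually.of_forall fun k => by
      have := hle k
      rw [hZU] at this
      exact this)
  obtain ⟨y1, y2⟩ := hEF.proj_mul_of_complementary hYa.1.2.2.2.1 hYa.1.2.1
  obtain ⟨-, -, -, e3, e4⟩ := hEF.moorePenrose_data
  rw [nonsing_inv_nonsing_inv _ ((isUnit_iff_isUnit_det _).1 hJ.isUnit)] at hW4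
  have hdom := two_mul_trace_le hEF.isComplProj hYa.1.2.2.2.1 y1 y2 e3 e4 hWs hW1 hW2 hW3
  -- The relation `Q V₀ Q = 0` gives the cone condition with `Eᵀ V₀ E = 0`. By stationarity `∇f ·
  -- d₀` reduces to `V₀ • Ya`, which depends only on that block.
  have hcrit : d₀ ∈ P.criticalCone xs E := by
    refine ⟨?_, hdH, ?_⟩
    · have h1 := gradL_analyticCenter hYa
      have h2 : inner ℝ d₀ (toEuclideanLin (P.gradH xs) za - P.adjG xs Ya) = 0 := by
        rw [inner_sub_right, inner_toEuclideanLin, hdH, inner_zero_left, inner_adjG, symBullet,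
          zero_sub, neg_eq_zero]
        have h3 := congrArg (fun X => (X * (Ya : Matrix (Fin m) (Fin m) ℝ)).trace) hQVQ
        simp only [zero_mul, trace_zero] at h3
        rw [mul_assoc _ (E * Eᵀ), y1, trace_mul_comm, ← mul_assoc, y2, trace_mul_comm] at h3
        exact h3
      rw [h1, inner_neg_right, neg_eq_zero, real_inner_comm] at h2
      exact h2
    · have h1 := congrArg (fun X => Eᵀ * X * E) hQVQ
      have h2 := hEF.blocks.1
      have h3 : Eᵀ * (E * Eᵀ * (P.deltaG xs d₀ : Matrix (Fin m) (Fin m) ℝ) * (E * Eᵀ)) * E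
          = (Eᵀ * E) * Eᵀ * (P.deltaG xs d₀ : Matrix (Fin m) (Fin m) ℝ) * E * (Eᵀ * E) := by
        simp only [Matrix.mul_assoc]
      simp only [h3, h2, Matrix.mul_one, Matrix.one_mul, Matrix.mul_zero, Matrix.zero_mul] at h1
      rw [h1]
      exact PosSemidef.zero
  have hpos := hSSOSC _ hYa.1 d₀ hcrit hd₀0
  rw [map_add, LinearMap.add_apply, inner_add_right, inner_sigmaMat] at hpos
  linarith

end Positivity

end NSDP

/-! ### The cone-shaped region around the central direction. -/

section ConeRegion

variable {n : ℕ} {xs ξ : EuclideanSpace ℝ (Fin n)}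

theorem mem_coneRegion {ρ μbar : ℝ} {x : EuclideanSpace ℝ (Fin n)} :
    x ∈ coneRegion xs ξ ρ μbar ↔ ∃ τ, (0 < τ ∧ τ ≤ μbar) ∧ ‖xs + τ • ξ - x‖ < ρ * τ * ‖ξ‖ := by
  simp [coneRegion, conePiece]

theorem coneRegion_mono {ρ ρ' μbar μbar' : ℝ} (hρ : ρ ≤ ρ') (hμ : μbar ≤ μbar') :
    coneRegion xs ξ ρ μbar ⊆ coneRegion xs ξ ρ' μbar' := by
  intro x hx
  obtain ⟨τ, ⟨h1, h2⟩, h3⟩ := mem_coneRegion.1 hx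
  refine mem_coneRegion.2 ⟨τ, ⟨h1, h2.trans hμ⟩, h3.trans_le ?_⟩
  gcongr

/-- One parameter `ε` bounds both the distance `τ ≤ ε` and the relative opening, so `(x - x*) / τ`
differs from `ξ` by at most `ε ‖ξ‖`. -/
theorem exists_tangent_of_mem_coneRegion {ι : Type*} {l : Filter ι} {ε : ι → ℝ}
    (hε : Tendsto ε l (𝓝 0)) {x : ι → EuclideanSpace ℝ (Fin n)}
    (hx : ∀ k, x k ∈ coneRegion xs ξ (ε k) (ε k)) :
    ∃ τ : ι → ℝ, (∀ k, 0 < τ k) ∧ Tendsto τ l (𝓝 0) ∧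
      Tendsto (fun k => (τ k)⁻¹ • (x k - xs)) l (𝓝 ξ) := by
  choose τ hτ hxτ using fun k => mem_coneRegion.1 (hx k)
  refine ⟨τ, fun k => (hτ k).1, squeeze_zero (fun k => (hτ k).1.le) (fun k => (hτ k).2) hε, ?_⟩
  rw [tendsto_iff_norm_sub_tendsto_zero]
  have h0 : Tendsto (fun k => ε k * ‖ξ‖) l (𝓝 0) := by simpa using hε.mul_const ‖ξ‖
  refine squeeze_zero (fun k => norm_nonneg _) (fun k => ?_) h0
  have h1 : (τ k)⁻¹ • (x k - xs) - ξ = -((τ k)⁻¹ • (xs + τ k • ξ - x k)) := by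
    have h2 : (τ k)⁻¹ • τ k • ξ = ξ := by
      rw [smul_smul, inv_mul_cancel₀ (hτ k).1.ne', one_smul]
    rw [smul_sub, smul_sub, smul_add, h2]
    abel
  rw [h1, norm_neg, norm_smul, norm_inv, Real.norm_of_nonneg (hτ k).1.le,
    inv_mul_le_iff₀ (hτ k).1]
  linarith [hxτ k]

end ConeRegion

namespace NSDP

/-! ### From families back to uniform radii. -/

section Assembly

variable {n m s p r : ℕ} {P : NSDP n m s} {xs ξ : EuclideanSpace ℝ (Fin n)}
  {E : Matrix (Fin m) (Fin p) ℝ} {F : Matrix (Fin m) (Fin r) ℝ} {Ya : SymMat m}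
  {za : EuclideanSpace ℝ (Fin s)}

theorem exists_forall_coneRegion_posDef
    (hEF : IsEigenFrame (P.G xs : Matrix (Fin m) (Fin m) ℝ) E F)
    (hYa : P.IsAnalyticCenter xs E Ya za) (hSC : P.StrictComplementarity xs)
    (hMFCQ : P.MFCQ xs) (hξ : P.IsCentralDirection xs E Ya za ξ) :
    ∃ ε > 0, ∀ x ∈ coneRegion xs ξ ε ε,
      (P.G x : Matrix (Fin m) (Fin m) ℝ).PosDef ∧ (P.gradH x).rank = s := by
  by_contra! hcon
  choose x hx hbad using fun k : ℕ => hcon (1 / ((k : ℝ) + 1)) Nat.one_div_pos_of_nat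
  have hε : Tendsto (fun k : ℕ => 1 / ((k : ℝ) + 1)) (hyperfilter ℕ) (𝓝 0) :=
    tendsto_one_div_add_atTop_nhds_zero_nat.mono_left Nat.hyperfilter_le_atTop
  obtain ⟨τ, hτ, hτ0, hlim⟩ := exists_tangent_of_mem_coneRegion hε hx
  have h1 := eventually_posDef_G hEF hYa hSC hξ (hyperfilter ℕ) hτ hτ0 hlim
  have h2 := P.eventually_rank_gradH (hyperfilter ℕ)
    (tendsto_of_tangent (hyperfilter ℕ) hτ hτ0 hlim) hMFCQ.2.2.1
  obtain ⟨k, hk1, hk2⟩ := (h1.and h2).exists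
  exact hbad k hk1 hk2

/-- The reduced Hessian of the barrier problem is positive definite at near-central points. -/
theorem exists_forall_reducedHessian_pos
    (hEF : IsEigenFrame (P.G xs : Matrix (Fin m) (Fin m) ℝ) E F)
    (hYa : P.IsAnalyticCenter xs E Ya za) (hSC : P.StrictComplementarity xs)
    (hSSOSC : P.SSOSC xs E) (hMFCQ : P.MFCQ xs) (hξ : P.IsCentralDirection xs E Ya za ξ)
    (γ₁ γ₂ : ℝ) {ε₁ : ℝ} (hε₁ : 0 < ε₁) (hpd : ∀ x ∈ coneRegion xs ξ ε₁ ε₁,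
      (P.G x : Matrix (Fin m) (Fin m) ℝ).PosDef) :
    ∃ ε > 0, ε ≤ ε₁ ∧ ∀ x ∈ coneRegion xs ξ ε ε, ∀ Y z, ∀ μ, 0 < μ → μ ≤ ε →
      P.NearCentral γ₁ γ₂ μ x Y z → ∀ d, d ≠ 0 → toEuclideanLin (P.gradH x)ᵀ d = 0 →
      0 < inner ℝ d (toEuclideanLin (P.hessL x Y z) d) +
        symBullet (P.deltaG x d) (Ring.inverse (lyapOp (P.G x)) (lyapOp Y (P.deltaG x d))) := by
  by_contra! hcon
  -- The minimum with `ε₁` keeps every point in the region where `G` is already known to be positive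
  -- definite.
  choose x hx Y z μ hμ hμε hN d hd0 hd hle using fun k : ℕ =>
    hcon (min ε₁ (1 / ((k : ℝ) + 1))) (lt_min hε₁ Nat.one_div_pos_of_nat) (min_le_left _ _)
  have hε0 : Tendsto (fun k : ℕ => 1 / ((k : ℝ) + 1)) (hyperfilter ℕ) (𝓝 0) :=
    tendsto_one_div_add_atTop_nhds_zero_nat.mono_left Nat.hyperfilter_le_atTop
  have hε : Tendsto (fun k : ℕ => min ε₁ (1 / ((k : ℝ) + 1))) (hyperfilter ℕ) (𝓝 0) := by
    have := (tendsto_const_nhds (x := ε₁)).min hε0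
    rwa [min_eq_right hε₁.le] at this
  obtain ⟨τ, hτ, hτ0, hlim⟩ := exists_tangent_of_mem_coneRegion hε hx
  -- The form is homogeneous of degree two in `d`, so the directions may be normalized.
  refine reducedHessian_pos_of_family (d := fun k => ‖d k‖⁻¹ • d k) hEF hYa hSC hSSOSC hMFCQ hξ
    (hyperfilter ℕ) hτ hτ0 hlim hμ
    (squeeze_zero (fun k => (hμ k).le) hμε hε) hN
    (fun k => hpd _ (coneRegion_mono (min_le_left _ _) (min_le_left _ _) (hx k)))
    (fun k => ?_) (fun k => ?_) fun k => ?_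
  · rw [norm_smul, norm_inv, norm_norm, inv_mul_cancel₀ (norm_ne_zero_iff.2 (hd0 k))]
  · rw [map_smul, hd, smul_zero]
  · have h1 : ∀ (c : ℝ) (U V : SymMat m), symBullet (c • U) V = c * symBullet U V := by
      intro c U V
      simp [symBullet]
    have h2 : ∀ (c : ℝ) (U V : SymMat m), symBullet U (c • V) = c * symBullet U V := by
      intro c U V
      simp [symBullet]
    simp only [map_smul, inner_smul_left, inner_smul_right, h1, h2, conj_trivial]
    have h3 : 0 ≤ ‖d k‖⁻¹ * ‖d k‖⁻¹ := mul_self_nonneg _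
    have h4 := mul_nonpos_of_nonneg_of_nonpos h3 (hle k)
    linarith

/-- Positivity of the reduced Hessian makes the Newton operator nonsingular. -/
theorem bijective_jacobianA {x : EuclideanSpace ℝ (Fin n)} {Y : SymMat m}
    {z : EuclideanSpace ℝ (Fin s)} (hG : (P.G x : Matrix (Fin m) (Fin m) ℝ).PosDef)
    (hrank : (P.gradH x).rank = s)
    (hpos : ∀ d, d ≠ 0 → toEuclideanLin (P.gradH x)ᵀ d = 0 →
      0 < inner ℝ d (toEuclideanLin (P.hessL x Y z) d) +
        symBullet (P.deltaG x d) (Ring.inverse (lyapOp (P.G x)) (lyapOp Y (P.deltaG x d)))) :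
    Function.Bijective (P.jacobianA x Y z) := by
  have hinj : Function.Injective (P.jacobianA x Y z) := by
    rw [injective_iff_map_eq_zero]
    rintro ⟨dx, dY, dz⟩ hw
    have e1 : toEuclideanLin (P.hessL x Y z) dx - P.adjG x dY + toEuclideanLin (P.gradH x) dz = 0 :=
      congrArg Prod.fst hw
    have e2 : lyapOp Y (P.deltaG x dx) + lyapOp (P.G x) dY = 0 :=
      congrArg (fun q => q.2.1) hw
    have e3 : toEuclideanLin (P.gradH x)ᵀ dx = 0 := congrArg (fun q => q.2.2) hw
    have hu := isUnit_lyapOp hG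
    have hcancel : ∀ U, Ring.inverse (lyapOp (P.G x)) (lyapOp (P.G x) U) = U := fun U => by
      simpa using LinearMap.congr_fun (Ring.inverse_mul_cancel _ hu) U
    have e4 : Ring.inverse (lyapOp (P.G x)) (lyapOp Y (P.deltaG x dx)) = -dY := by
      rw [eq_neg_of_add_eq_zero_left e2, map_neg, hcancel]
    -- Pairing the first row with `dx` removes `dz` by the third row. With `dY` expressed by the
    -- second row, what remains is exactly the quadratic form of `hpos` at `dx`.
    have e5 : inner ℝ dx (toEuclideanLin (P.hessL x Y z) dx) - symBullet
      (P.deltaG x dx) dY = 0 := by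
      have := congrArg (fun u => inner ℝ dx u) e1
      simp only [inner_add_right, inner_sub_right, inner_zero_right, inner_adjG] at this
      rwa [inner_toEuclideanLin (P.gradH x), e3, inner_zero_left, add_zero] at this
    have hdx : dx = 0 := by
      by_contra h0
      have h1 := hpos dx h0 e3
      have h2 : symBullet (P.deltaG x dx) (-dY) = -symBullet (P.deltaG x dx) dY := by
        simp [symBullet]
      rw [e4, h2] at h1
      linarith
    subst hdx
    have hdY : dY = 0 := by
      have h1 := hcancel dY
      rw [map_zero, map_zero, zero_add] at e2
      rw [← h1, e2, map_zero]
    subst hdY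
    have hdz : dz = 0 := by
      rw [map_zero, map_zero, sub_zero, zero_add] at e1
      exact (injective_toEuclideanLin_iff _).1 hrank dz e1
    rw [hdz]
    rfl
  exact ⟨hinj, LinearMap.injective_iff_surjective.1 hinj⟩

end Assembly

end NSDP

end NearCentralPoints

theorem proposition3p6 {n m s p r : ℕ} (P : NSDP n m s) (xs : EuclideanSpace ℝ (Fin n))
    (E : Matrix (Fin m) (Fin p) ℝ) (F : Matrix (Fin m) (Fin r) ℝ)
    (hEF : IsEigenFrame (P.G xs : Matrix (Fin m) (Fin m) ℝ) E F)
    (hKKT : P.IsKKTPoint xs) (hSC : P.StrictComplementarity xs) (hSSOSC : P.SSOSC xs E)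
    (hMFCQ : P.MFCQ xs)
    (Ya : SymMat m) (za : EuclideanSpace ℝ (Fin s)) (hYa : P.IsAnalyticCenter xs E Ya za)
    (ξ : EuclideanSpace ℝ (Fin n)) (hξ : P.IsCentralDirection xs E Ya za ξ)
    (γ₁ γ₂ : ℝ) (hγ₁ : 0 < γ₁) (hγ₂ : 0 < γ₂) :
    ∃ μ₀ > 0, ∃ ρ₀ > 0, ∀ μbar ∈ Ioc 0 μ₀, ∀ ρbar ∈ Ioc 0 ρ₀,
      (∀ x ∈ coneRegion xs ξ ρbar μbar,
        (P.G x : Matrix (Fin m) (Fin m) ℝ).PosDef ∧ IsUnit (lyapOp (P.G x)) ∧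
          (P.gradH x).rank = s) ∧
      (∀ (x : EuclideanSpace ℝ (Fin n)) (Y : SymMat m) (z : EuclideanSpace ℝ (Fin s)),
        (Y : Matrix (Fin m) (Fin m) ℝ).PosDef → x ∈ coneRegion xs ξ ρbar μbar →
        ∀ μ ∈ Ioc 0 μbar, P.NearCentral γ₁ γ₂ μ x Y z →
        ∀ d : EuclideanSpace ℝ (Fin n), d ≠ 0 → toEuclideanLin (P.gradH x)ᵀ d = 0 →
          0 < inner ℝ d (toEuclideanLin (P.hessL x Y z) d) +
            symBullet (P.deltaG x d) (Ring.inverse (lyapOp (P.G x)) (lyapOp Y (P.deltaG x d)))) ∧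
      (∀ (x : EuclideanSpace ℝ (Fin n)) (Y : SymMat m) (z : EuclideanSpace ℝ (Fin s)),
        x ∈ coneRegion xs ξ ρbar μbar →
        ∀ μ ∈ Ioc 0 μbar, P.NearCentral γ₁ γ₂ μ x Y z →
        Function.Bijective (P.jacobianA x Y z)) := by
  obtain ⟨ε₁, hε₁, h₁⟩ := P.exists_forall_coneRegion_posDef hEF hYa hSC hMFCQ hξ
  obtain ⟨ε, hε, hεε₁, h₂⟩ := P.exists_forall_reducedHessian_pos hEF hYa hSC hSSOSC hMFCQ hξ γ₁ γ₂
    hε₁ fun x hx => (h₁ x hx).1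
  -- A single `ε` bounds both parameters, since the regions grow with each of them.
  refine ⟨ε, hε, ε, hε, fun μbar hμbar ρbar hρbar => ?_⟩
  have hcone : coneRegion xs ξ ρbar μbar ⊆ coneRegion xs ξ ε ε :=
    coneRegion_mono hρbar.2 hμbar.2
  have hcone₁ : coneRegion xs ξ ε ε ⊆ coneRegion xs ξ ε₁ ε₁ := coneRegion_mono hεε₁ hεε₁
  refine ⟨fun x hx => ?_, fun x Y z _ hx μ hμ hN => ?_, fun x Y z hx μ hμ hN => ?_⟩
  · obtain ⟨h3, h4⟩ := h₁ x (hcone₁ (hcone hx))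
    exact ⟨h3, isUnit_lyapOp h3, h4⟩
  · exact h₂ x (hcone hx) Y z μ hμ.1 (hμ.2.trans hμbar.2) hN
  · obtain ⟨h3, h4⟩ := h₁ x (hcone₁ (hcone hx))
    exact NSDP.bijective_jacobianA h3 h4 (h₂ x (hcone hx) Y z μ hμ.1 (hμ.2.trans hμbar.2) hN)
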